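/- Let $N\ge 1$, $B_N=\{z\in\mathbb C^N:|z|<1\}$ and $\langle z,w\rangle=\sum_{i}z_i\overline{w_i}$. Let $\sigma$ be the normalized surface measure on $\partial B_N$ and $v$ the normalized volume measure on $B_N$. The Hardy space $H^2(B_N)$ consists of the holomorphic functions $f$ on $B_N$ with $$\|f\|^2=\sup_{0<r<1}\int_{\partial B_N}|f(r\zeta)|^2\,d\sigma(\zeta)<\infty ,$$ and, for real $s>-1$, the weighted Bergman space $A^2_s(B_N)$ consists of the holomorphic functions $f$ on $B_N$ with $$\|f\|^2=\int_{B_N}|f|^2\,dv_s<\infty,\qquad dv_s(z)=\frac{\Gamma(N+s+1)}{N!\,\Gamma(s+1)}(1-|z|^2)^s\,dv(z).$$ Let $\mathcal H$ be one of these spaces, and put $t=N$ if $\mathcal H=H^2(B_N)$ and $t=N+s+1$ if $\mathcal H=A^2_s(B_N)$. Let $\varphi$ be an automorphism (biholomorphic self-map) of $B_N$ with $a=\varphi^{-1}(0)\neq 0$, let $C_\varphi f=f\circ\varphi$, and for $m\ge 0$ let $$e_m(z)=\sqrt{\frac{\Gamma(t+m)}{\Gamma(t)\,m!}}\,\Bigl\langle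 z,\frac{a}{|a|}\Bigr\rangle^m .$$ Then $e_m$ and $C_\varphi e_m$ belong to $\mathcal H$ for every $m$, the limit $\lim_{m\to\infty}\|C_\varphi e_m\|_{\mathcal H}^2$ exists, and $$\lim_{m\to\infty}\|C_\varphi e_m\|_{\mathcal H}^2\le(1-|a|^2)^t\sum_{k=0}^\infty\left(\frac{\Gamma(t+k)}{k!\,\Gamma(t)}\right)^2|a|^{2k},$$ where the series converges. -/

import Mathlib

open MeasureTheory Filter Topology Metric
open scoped ENNReal

noncomputable section

namespace BallSpaces

/-- `ℂ^N` with its Euclidean norm. -/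
abbrev CN (N : ℕ) : Type := EuclideanSpace ℂ (Fin N)

/-- The open unit ball `B_N` of `ℂ^N`. -/
abbrev unitBall (N : ℕ) : Set (CN N) := ball (0 : CN N) 1

/-- The Hermitian product `⟨z, w⟩ = ∑ z_i * conj w_i`, linear in the first variable
(Mathlib's `inner ℂ` is linear in the second one). -/
def herm {N : ℕ} (z w : CN N) : ℂ := inner ℂ w z

theorem herm_eq_sum {N : ℕ} (z w : CN N) :
    herm z w = ∑ i, z i * (starRingEnd ℂ) (w i) := by
  simp [herm, PiLp.inner_apply]

/-- The normalized surface measure on the unit sphere `∂B_N`. -/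
def sphereMeasure (N : ℕ) : Measure (sphere (0 : CN N) 1) :=
  ((volume : Measure (CN N)).toSphere Set.univ)⁻¹ • (volume : Measure (CN N)).toSphere

/-- The normalized volume measure on `B_N`, as a measure on `ℂ^N` carried by `B_N`. -/
def ballMeasure (N : ℕ) : Measure (CN N) :=
  (volume (unitBall N))⁻¹ • volume.restrict (unitBall N)

/-- The weighted measure `dv_s = c_s (1 - |z|^2)^s dv` with
`c_s = Γ(N + s + 1) / (N! Γ(s + 1))`. -/
def weightedMeasure (N : ℕ) (s : ℝ) : Measure (CN N) :=
  (ballMeasure N).withDensity fun z =>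
    ENNReal.ofReal
      (Real.Gamma (N + s + 1) / (N.factorial * Real.Gamma (s + 1)) * (1 - ‖z‖ ^ 2) ^ s)

/-- The squared Hardy norm `sup_{0<r<1} ∫_{∂B_N} |f(r ζ)|^2 dσ(ζ)`, possibly infinite.
It depends only on the values of `f` on `B_N`. -/
def hardyNormSq {N : ℕ} (f : CN N → ℂ) : ℝ≥0∞ :=
  ⨆ r ∈ Set.Ioo (0 : ℝ) 1,
    ∫⁻ ζ : sphere (0 : CN N) 1, ‖f (r • (ζ : CN N))‖ₑ ^ 2 ∂(sphereMeasure N)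

/-- The Hardy space `H^2(B_N)`: functions holomorphic in `B_N` of finite Hardy norm
(their values outside `B_N` play no role). -/
def hardySpace (N : ℕ) : Set (CN N → ℂ) :=
  {f | DifferentiableOn ℂ f (unitBall N) ∧ hardyNormSq f < ∞}

/-- The squared norm `∫_{B_N} |f|^2 dv_s`, possibly infinite.
It depends only on the values of `f` on `B_N`. -/
def bergmanNormSq {N : ℕ} (s : ℝ) (f : CN N → ℂ) : ℝ≥0∞ :=
  ∫⁻ z in unitBall N, ‖f z‖ₑ ^ 2 ∂(weightedMeasure N s)

/-- The weighted Bergman space `A^2_s(B_N)`: functions holomorphic in `B_N` of finite norm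
(their values outside `B_N` play no role). -/
def bergmanSpace (N : ℕ) (s : ℝ) : Set (CN N → ℂ) :=
  {f | DifferentiableOn ℂ f (unitBall N) ∧ bergmanNormSq s f < ∞}

/-- The composition operator `C_φ f = f ∘ φ`. -/
def compositionOp {N : ℕ} (φ : CN N → CN N) (f : CN N → ℂ) : CN N → ℂ := f ∘ φ

/-- `φ` restricts to an automorphism of `B_N`: a holomorphic bijection of `B_N` onto itself
with holomorphic inverse. -/
def IsBallAutomorphism {N : ℕ} (φ : CN N → CN N) : Prop :=
  DifferentiableOn ℂ φ (unitBall N) ∧ Set.MapsTo φ (unitBall N) (unitBall N) ∧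
    ∃ ψ : CN N → CN N,
      DifferentiableOn ℂ ψ (unitBall N) ∧ Set.MapsTo ψ (unitBall N) (unitBall N) ∧
        Set.InvOn ψ φ (unitBall N) (unitBall N)

/-- `e_m(z) = √(Γ(t + m) / (Γ(t) m!)) ⟨z, a/|a|⟩^m`. -/
def testFun {N : ℕ} (t : ℝ) (a : CN N) (m : ℕ) (z : CN N) : ℂ :=
  (Real.sqrt (Real.Gamma (t + m) / (Real.Gamma t * m.factorial)) : ℂ) *
    herm z ((‖a‖⁻¹ : ℝ) • a) ^ m

end BallSpaces

end

namespace BallSpaces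

/-! ### The Hermitian product -/

variable {N : ℕ}

/-! Write `φ = U ∘ φ_a`, with `φ_a` the involution exchanging `0` and `a` and `U` unitary: this is
the equality case of the Schwarz lemma. With `u = U⁻¹(a/|a|)` and `b_k = Γ(t+k)/(k! Γ(t))`, the
function `C_φ e_m` is `√b_m ⟨φ_a(z), u⟩^m` on the ball.

In the Bergman case, substituting `φ_a` turns its squared norm into `b_m (1-|a|²)^t ∫ |⟨z,u⟩|^(2m)
|1-⟨z,a⟩|^(-2t) dv_s` (`lintegral_comp_ballInvolution`). Expanding `(1-⟨z,a⟩)^(-t)` in powers of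
`⟨z,a⟩` gives homogeneous terms of distinct degrees, hence orthogonal, and Parseval leaves `b_m
(1-|a|²)^t ∑ b_k² ∫ |⟨z,u⟩|^(2m) |⟨z,a⟩|^(2k) dv_s`.

The measures `b_m |⟨z,u⟩|^(2m) dv_s` have mass one and concentrate on the circle through `u`, where
`|⟨z,a⟩| = |⟨u,a⟩|` (`tendsto_mul_pairMoment`). By dominated convergence the limit is `(1-|a|²)^t ∑
b_k² |⟨u,a⟩|^(2k)`, and Cauchy–Schwarz bounds `|⟨u,a⟩|` by `|a|`.

The Hardy formula is obtained without a change of variables on the sphere: it is the limit of the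
Bergman formulas as `s → -1` (`hardyNormSq_involutionPow`). Concentration then applies to the
surface measure as before. -/

theorem herm_add_left (z w a : CN N) : herm (z + w) a = herm z a + herm w a := inner_add_right ..

theorem herm_sub_left (z w a : CN N) : herm (z - w) a = herm z a - herm w a := inner_sub_right ..

theorem herm_smul_left (c : ℂ) (z a : CN N) : herm (c • z) a = c * herm z a := inner_smul_right ..

theorem herm_smul_right (c : ℂ) (z a : CN N) : herm z (c • a) = starRingEnd ℂ c * herm z a :=
  inner_smul_left ..

theorem herm_sub_right (z w a : CN N) : herm a (z - w) = herm a z - herm a w := inner_sub_left ..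

theorem herm_comm (z w : CN N) : herm z w = starRingEnd ℂ (herm w z) := (inner_conj_symm _ _).symm

theorem herm_self (z : CN N) : herm z z = (‖z‖ : ℂ) ^ 2 := inner_self_eq_norm_sq_to_K z

theorem herm_zero_left (a : CN N) : herm 0 a = 0 := inner_zero_right _

theorem norm_herm_le (z w : CN N) : ‖herm z w‖ ≤ ‖z‖ * ‖w‖ := by
  rw [mul_comm]; exact norm_inner_le_norm w z

theorem one_sub_herm_ne_zero {z a : CN N} (hz : ‖z‖ ≤ 1) (ha : ‖a‖ < 1) : 1 - herm z a ≠ 0 := by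
  intro h
  have h1 : ‖herm z a‖ = 1 := by rw [← sub_eq_zero.1 h]; simp
  have := norm_herm_le z a
  nlinarith [norm_nonneg a, norm_nonneg z]

@[fun_prop]
theorem continuous_herm_left (a : CN N) : Continuous fun z : CN N => herm z a :=
  continuous_const.inner continuous_id

/-! ### The involution of the ball exchanging `0` and `a` -/

/-- `√(1 - |a|²)`. -/
noncomputable def defect (a : CN N) : ℝ := √(1 - ‖a‖ ^ 2)

/-- The involutive automorphism of the ball exchanging `0` and `a`. -/
noncomputable def ballInvolution (a z : CN N) : CN N :=
  (1 - herm z a)⁻¹ • ((1 - (1 + (defect a : ℂ))⁻¹ * herm z a) • a - (defect a : ℂ) • z)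

variable {a : CN N}

theorem defect_nonneg (a : CN N) : 0 ≤ defect a := Real.sqrt_nonneg _

theorem defect_sq (ha : ‖a‖ < 1) : defect a ^ 2 = 1 - ‖a‖ ^ 2 :=
  Real.sq_sqrt (by nlinarith [norm_nonneg a])

theorem defect_pos (ha : ‖a‖ < 1) : 0 < defect a :=
  Real.sqrt_pos.2 (by nlinarith [norm_nonneg a])

theorem one_add_defect_ne_zero (a : CN N) : (1 + (defect a : ℂ)) ≠ 0 := by
  have := defect_nonneg a
  exact_mod_cast (by positivity : (1 + defect a) ≠ 0)

/-- Eliminates `|a|²` in favour of `s = √(1-|a|²)`. It also explains the shape of `ballInvolution`: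
the usual coefficient `(1-s)/|a|²` of the projection onto `a` equals `1/(1+s)`, which needs no `a ≠
0`. -/
theorem ofReal_defect_sq (ha : ‖a‖ < 1) : (‖a‖ : ℂ) ^ 2 = 1 - (defect a : ℂ) ^ 2 := by
  have h := defect_sq ha
  have : ‖a‖ ^ 2 = 1 - defect a ^ 2 := by linarith
  exact_mod_cast this

theorem ballInvolution_self (ha : ‖a‖ < 1) : ballInvolution a a = 0 := by
  have h : (1 - (1 + (defect a : ℂ))⁻¹ * herm a a) = defect a := by
    have := one_add_defect_ne_zero a
    rw [herm_self, ofReal_defect_sq ha]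
    field_simp
    ring
  rw [ballInvolution, h, sub_self, smul_zero]

theorem ballInvolution_zero (a : CN N) : ballInvolution a 0 = a := by
  simp [ballInvolution, herm_zero_left]

theorem herm_ballInvolution (ha : ‖a‖ < 1) (z : CN N) :
    herm (ballInvolution a z) a = (‖a‖ ^ 2 - herm z a) / (1 - herm z a) := by
  have := one_add_defect_ne_zero a
  rw [ballInvolution, herm_smul_left, herm_sub_left, herm_smul_left, herm_smul_left, herm_self,
    ofReal_defect_sq ha, div_eq_inv_mul]
  congr 1
  field_simp
  ring

theorem one_sub_herm_ballInvolution (ha : ‖a‖ < 1) {z : CN N} (hz : 1 - herm z a ≠ 0) :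
    1 - herm (ballInvolution a z) a = (defect a : ℂ) ^ 2 / (1 - herm z a) := by
  rw [herm_ballInvolution ha, ofReal_defect_sq ha]
  field_simp
  ring

theorem one_sub_norm_sq_ballInvolution (ha : ‖a‖ < 1) {z : CN N} (hz : 1 - herm z a ≠ 0) :
    1 - ‖ballInvolution a z‖ ^ 2 = (1 - ‖a‖ ^ 2) * (1 - ‖z‖ ^ 2) / ‖1 - herm z a‖ ^ 2 := by
  have h1 := one_add_defect_ne_zero a
  have hn : ((‖1 - herm z a‖ : ℝ) : ℂ) ^ 2 = (1 - herm z a) * (1 - starRingEnd ℂ (herm z a)) := by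
    rw [← Complex.mul_conj', map_sub, map_one]
  have hz' : 1 - starRingEnd ℂ (herm z a) ≠ 0 := by
    rw [← map_one (starRingEnd ℂ), ← map_sub]
    exact (map_ne_zero _).2 hz
  have key : (1 : ℂ) - (‖ballInvolution a z‖ : ℂ) ^ 2 =
      (1 - (‖a‖ : ℂ) ^ 2) * (1 - (‖z‖ : ℂ) ^ 2) / (‖1 - herm z a‖ : ℂ) ^ 2 := by
    rw [hn, ← herm_self (ballInvolution a z), ballInvolution, herm_smul_left, herm_smul_right]
    simp only [herm_sub_left, herm_sub_right, herm_smul_left, herm_smul_right]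
    simp only [herm_self, herm_comm a z, ofReal_defect_sq ha, map_sub, map_mul, map_inv₀, map_one, map_add,
      Complex.conj_ofReal]
    -- With `⟨z,a⟩` and its conjugate as independent variables, this is an identity of rational
    -- functions.
    generalize starRingEnd ℂ (herm z a) = q at *
    generalize herm z a = p at *
    generalize (defect a : ℂ) = s at *
    field_simp
    ring
  exact_mod_cast key

theorem ballInvolution_mapsTo (ha : ‖a‖ < 1) :
    Set.MapsTo (ballInvolution a) (unitBall N) (unitBall N) := by
  intro z hz
  rw [mem_ball_zero_iff] at hz ⊢
  have h0 := one_sub_herm_ne_zero hz.le ha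
  have h := one_sub_norm_sq_ballInvolution ha h0
  have : 0 < (1 - ‖a‖ ^ 2) * (1 - ‖z‖ ^ 2) / ‖1 - herm z a‖ ^ 2 := by
    have := norm_pos_iff.2 h0
    have h1 : 0 < 1 - ‖a‖ ^ 2 := by nlinarith [norm_nonneg a]
    have h2 : 0 < 1 - ‖z‖ ^ 2 := by nlinarith [norm_nonneg z]
    positivity
  nlinarith [norm_nonneg (ballInvolution a z)]

theorem ballInvolution_ballInvolution (ha : ‖a‖ < 1) {z : CN N} (hz : 1 - herm z a ≠ 0) :
    ballInvolution a (ballInvolution a z) = z := by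
  have h1 := one_add_defect_ne_zero a
  have hs : (defect a : ℂ) ≠ 0 := by exact_mod_cast (defect_pos ha).ne'
  rw [ballInvolution, one_sub_herm_ballInvolution ha hz, herm_ballInvolution ha,
    ofReal_defect_sq ha, ballInvolution]
  generalize herm z a = p at *
  generalize (defect a : ℂ) = s at *
  match_scalars
  · field_simp
    ring
  · field_simp

/-- `herm · a` as a linear form. -/
noncomputable def hermCLM (a : CN N) : CN N →L[ℂ] ℂ := innerSL ℂ a

@[simp] theorem hermCLM_apply (a z : CN N) : hermCLM a z = herm z a := rfl

/-- The derivative of `ballInvolution a` at `z`. -/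
noncomputable def ballInvolutionDeriv (a z : CN N) : CN N →L[ℂ] CN N :=
  (-(defect a : ℂ) / (1 - herm z a)) • (ContinuousLinearMap.id ℂ (CN N) +
    (hermCLM a).smulRight (((defect a : ℂ)⁻¹ * (1 + (defect a : ℂ))⁻¹) • a -
      (defect a : ℂ)⁻¹ • ballInvolution a z))

theorem hasFDerivAt_ballInvolution (ha : ‖a‖ < 1) {z : CN N} (hz : 1 - herm z a ≠ 0) :
    HasFDerivAt (ballInvolution a) (ballInvolutionDeriv a z) z := by
  have hs : (defect a : ℂ) ≠ 0 := by exact_mod_cast (defect_pos ha).ne'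
  have hp : HasFDerivAt (fun z : CN N => herm z a) (hermCLM a) z := (hermCLM a).hasFDerivAt
  have h1 := ((hasDerivAt_inv hz).comp_hasFDerivAt z (hp.const_sub 1)).smul
    ((((hp.const_mul (1 + (defect a : ℂ))⁻¹).const_sub 1).smul_const a).sub
      ((hasFDerivAt_id z).const_smul (defect a : ℂ)))
  refine h1.congr_fderiv ?_
  ext1 h
  simp only [Pi.sub_apply, Pi.smul_apply, Function.comp_apply, ballInvolutionDeriv, ballInvolution, add_apply,
    smul_apply, sub_apply, neg_apply,
    ContinuousLinearMap.smulRight_apply, hermCLM_apply, ContinuousLinearMap.id_apply, id]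
  have := one_add_defect_ne_zero a
  generalize herm z a = p at *
  generalize (defect a : ℂ) = s at *
  simp only [smul_eq_mul]
  match_scalars
  all_goals field_simp
  all_goals ring

/-- The derivative is a scalar times a rank-one perturbation `id + f ⊗ v`, whose determinant is `1 +
f(v) = s/(1-⟨z,a⟩)`. The scalar contributes the other `N` factors. -/
theorem det_ballInvolutionDeriv (ha : ‖a‖ < 1) {z : CN N} (hz : 1 - herm z a ≠ 0) :
    LinearMap.det (ballInvolutionDeriv a z : CN N →ₗ[ℂ] CN N) =
      (-1) ^ N * ((defect a : ℂ) / (1 - herm z a)) ^ (N + 1) := by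
  have hs : (defect a : ℂ) ≠ 0 := by exact_mod_cast (defect_pos ha).ne'
  have h1 := one_add_defect_ne_zero a
  have : (ballInvolutionDeriv a z : CN N →ₗ[ℂ] CN N) =
      (-(defect a : ℂ) / (1 - herm z a)) • LinearMap.transvection
        (hermCLM a : CN N →ₗ[ℂ] ℂ) (((defect a : ℂ)⁻¹ * (1 + (defect a : ℂ))⁻¹) • a -
      (defect a : ℂ)⁻¹ • ballInvolution a z) := by
    ext1 h
    simp [ballInvolutionDeriv, LinearMap.transvection.apply]
  rw [this, LinearMap.det_smul, LinearMap.transvection.det]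
  simp only [finrank_euclideanSpace, Fintype.card_fin, ContinuousLinearMap.coe_coe, hermCLM_apply,
    herm_sub_left, herm_smul_left, herm_self, herm_ballInvolution ha, ofReal_defect_sq ha]
  have : (1 + ((defect a : ℂ)⁻¹ * (1 + (defect a : ℂ))⁻¹ * (1 - (defect a : ℂ) ^ 2) -
      (defect a : ℂ)⁻¹ * ((1 - (defect a : ℂ) ^ 2 - herm z a) / (1 - herm z a)))) =
      (defect a : ℂ) / (1 - herm z a) := by
    field_simp
    ring
  rw [this, pow_succ, ← mul_assoc, ← mul_pow]
  ring

theorem abs_det_ballInvolutionDeriv (ha : ‖a‖ < 1) {z : CN N} (hz : 1 - herm z a ≠ 0) :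
    |((ballInvolutionDeriv a z).restrictScalars ℝ).det| =
      ((1 - ‖a‖ ^ 2) / ‖1 - herm z a‖ ^ 2) ^ (N + 1) := by
  -- The real determinant of a complex-linear map is the squared modulus of its complex determinant.
  have h : ((ballInvolutionDeriv a z).restrictScalars ℝ).det =
      Algebra.norm ℝ (LinearMap.det (ballInvolutionDeriv a z : CN N →ₗ[ℂ] CN N)) :=
    LinearMap.det_restrictScalars
  rw [h, det_ballInvolutionDeriv ha hz, Algebra.norm_complex_eq]
  have h2 : ‖(-1 : ℂ) ^ N * ((defect a : ℂ) / (1 - herm z a)) ^ (N + 1)‖ ^ 2 =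
      ((1 - ‖a‖ ^ 2) / ‖1 - herm z a‖ ^ 2) ^ (N + 1) := by
    rw [← defect_sq ha]
    simp [div_pow, ← pow_mul, mul_comm, abs_of_nonneg (defect_nonneg a)]
  rw [← h2, ← Complex.normSq_eq_norm_sq]
  exact abs_of_nonneg (Complex.normSq_nonneg _)

theorem differentiableOn_ballInvolution (ha : ‖a‖ < 1) :
    DifferentiableOn ℂ (ballInvolution a) (unitBall N) := fun _ hz =>
  (hasFDerivAt_ballInvolution ha (one_sub_herm_ne_zero (mem_ball_zero_iff.1 hz).le ha)
    ).differentiableAt.differentiableWithinAt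

end BallSpaces

namespace BallSpaces

variable {N : ℕ}

/-! ### Automorphisms of the ball -/

/-- A holomorphic self-map of the ball that preserves norms is the restriction of a linear
isometry. -/
theorem exists_linearIsometry_of_norm_eq {G : CN N → CN N}
    (hd : DifferentiableOn ℂ G (unitBall N)) (hG : ∀ z ∈ unitBall N, ‖G z‖ = ‖z‖) :
    ∃ U : CN N →ₗᵢ[ℂ] CN N, ∀ z ∈ unitBall N, G z = U z := by
  have h0 : G 0 = 0 := by simpa using hG 0 (by simp)
  have hlin : ∀ z ∈ unitBall N, G z = fderiv ℂ G 0 z := by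
    intro z hz
    rcases eq_or_ne z 0 with rfl | hz0
    · simp [h0]
    have hzn : (‖z‖ : ℂ) ≠ 0 := by simpa using hz0
    set w : CN N := (‖z‖ : ℂ)⁻¹ • z with hw
    have hw1 : ‖w‖ = 1 := by simp [hw, norm_smul, hz0]
    -- On each complex line `G` attains equality in the Schwarz lemma, so it is linear there with
    -- slope its derivative at `0`. The point `1/2` below could be any nonzero point of the disc.
    set g : ℂ → CN N := fun c => G (c • w) with hg
    have hmem : ∀ c ∈ ball (0 : ℂ) 1, c • w ∈ unitBall N := by
      intro c hc
      simpa [norm_smul, hw1] using hc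
    have hgd : DifferentiableOn ℂ g (ball 0 1) :=
      hd.comp (differentiable_id.smul_const w).differentiableOn hmem
    have hgn : ∀ c ∈ ball (0 : ℂ) 1, ‖g c‖ = ‖c‖ := by
      intro c hc
      rw [hg, hG _ (hmem c hc), norm_smul, hw1, mul_one]
    have hg0 : g 0 = 0 := by simp [hg, h0]
    have hhalf : (1 / 2 : ℂ) ∈ ball (0 : ℂ) 1 := by simp; norm_num
    have haff := Complex.affine_of_mapsTo_ball_of_norm_dslope_eq_div (R₂ := 1) hgd
      (fun c hc => by rw [hg0, mem_closedBall_zero_iff, hgn c hc]; exact (mem_ball_zero_iff.1 hc).le)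
      hhalf (by
        rw [dslope_of_ne _ (by norm_num), slope_def_module, norm_smul, hg0, sub_zero, sub_zero,
          hgn _ hhalf]
        norm_num)
    set d := dslope g 0 (1 / 2) with hd'
    have hfd : HasFDerivAt G (fderiv ℂ G 0) 0 :=
      ((hd.differentiableAt (ball_mem_nhds 0 one_pos))).hasFDerivAt
    have h1 : HasDerivAt g (fderiv ℂ G 0 w) 0 := by
      have h2 : HasDerivAt (fun c : ℂ => c • w) w 0 := by
        simpa using (hasDerivAt_id (0 : ℂ)).smul_const w
      have h3 : HasFDerivAt G (fderiv ℂ G 0) ((0 : ℂ) • w) := by rwa [zero_smul]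
      exact h3.comp_hasDerivAt 0 h2
    have h4 : HasDerivAt g d 0 := by
      have h5 : HasDerivAt (fun c : ℂ => g 0 + (c - 0) • d) d 0 := by
        simpa using ((hasDerivAt_id (0 : ℂ)).smul_const d).const_add (g 0)
      exact h5.congr_of_eventuallyEq (haff.eventuallyEq_of_mem (ball_mem_nhds 0 one_pos))
    have h6 := haff (x := (‖z‖ : ℂ)) (by simpa using hz)
    have h7 : (‖z‖ : ℂ) • w = z := by rw [hw, smul_smul, mul_inv_cancel₀ hzn, one_smul]
    simp only [hg0, zero_add, sub_zero, h4.unique h1, ← map_smul, h7] at h6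
    rw [← h6, hg]
    simp only [h7]
  refine ⟨⟨(fderiv ℂ G 0 : CN N →ₗ[ℂ] CN N), fun z => ?_⟩, hlin⟩
  have hpos : 0 < 1 + ‖z‖ := by positivity
  -- Rescales an arbitrary vector into the ball, where the norm is known to be preserved.
  set c : ℂ := ((1 + ‖z‖ : ℝ) : ℂ)⁻¹ with hc
  have hc0 : 0 < ‖c‖ := by
    rw [hc, norm_inv, Complex.norm_real, Real.norm_of_nonneg hpos.le]
    positivity
  have hcz : c • z ∈ unitBall N := by
    rw [mem_ball_zero_iff, norm_smul, hc, norm_inv, Complex.norm_real, Real.norm_of_nonneg hpos.le,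
      inv_mul_lt_iff₀ hpos]
    linarith
  have := hG _ hcz
  rw [hlin _ hcz, map_smul, norm_smul, norm_smul] at this
  exact mul_left_cancel₀ hc0.ne' this

/-- Every automorphism of the ball vanishing at `a` is the composition of the involution
exchanging `0` and `a` with a unitary map. -/
theorem IsBallAutomorphism.exists_unitary {φ : CN N → CN N} (hφ : IsBallAutomorphism φ)
    {a : CN N} (ha : a ∈ unitBall N) (hφa : φ a = 0) :
    ∃ U : CN N ≃ₗᵢ[ℂ] CN N, ∀ z ∈ unitBall N, φ z = U (ballInvolution a z) := by
  obtain ⟨hφd, hφm, ψ, hψd, hψm, hl, hr⟩ := hφ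
  have ha1 : ‖a‖ < 1 := mem_ball_zero_iff.1 ha
  have hinv : ∀ z ∈ unitBall N, ballInvolution a (ballInvolution a z) = z := fun z hz =>
    ballInvolution_ballInvolution ha1 (one_sub_herm_ne_zero (mem_ball_zero_iff.1 hz).le ha1)
  have hm := ballInvolution_mapsTo (N := N) ha1
  have hd := differentiableOn_ballInvolution (N := N) ha1
  have hψ0 : ψ 0 = a := by rw [← hφa, hl ha]
  have hGd : DifferentiableOn ℂ (φ ∘ ballInvolution a) (unitBall N) := hφd.comp hd hm
  have hHd : DifferentiableOn ℂ (ballInvolution a ∘ ψ) (unitBall N) := hd.comp hψd hψm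
  have hGm := hφm.comp hm
  have hHm := hm.comp hψm
  -- The Schwarz lemma for `φ ∘ φ_a` gives one inequality; for its inverse `φ_a ∘ ψ` it gives the
  -- other.
  obtain ⟨U, hU⟩ := exists_linearIsometry_of_norm_eq hGd fun z hz => by
    refine le_antisymm (Complex.norm_le_norm_of_mapsTo_ball hGd
      (hGm.mono_right ball_subset_closedBall) (by simp [ballInvolution_zero, hφa])
      (mem_ball_zero_iff.1 hz)) ?_
    have h := Complex.norm_le_norm_of_mapsTo_ball hHd (hHm.mono_right ball_subset_closedBall)
      (by simp [hψ0, ballInvolution_self ha1]) (mem_ball_zero_iff.1 (hGm hz))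
    simpa only [Function.comp_apply, hl (hm hz), hinv z hz] using h
  refine ⟨U.toLinearIsometryEquiv rfl, fun z hz => ?_⟩
  have := hU _ (hm hz)
  rwa [Function.comp_apply, hinv z hz] at this

theorem herm_unitary (U : CN N ≃ₗᵢ[ℂ] CN N) (z w : CN N) : herm (U z) w = herm z (U.symm w) := by
  rw [herm, herm, ← U.inner_map_map (U.symm w) z, U.apply_symm_apply]

end BallSpaces

namespace BallSpaces

variable {N : ℕ} {a : CN N}

/-! ### Change of variables in the weighted measures -/

/-- The Poisson-type factor `(1 - |a|²) / |1 - ⟨z, a⟩|²`. -/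
noncomputable def poissonFactor (a z : CN N) : ℝ := (1 - ‖a‖ ^ 2) / ‖1 - herm z a‖ ^ 2

theorem one_sub_norm_sq_pos {z : CN N} (hz : ‖z‖ < 1) : 0 < 1 - ‖z‖ ^ 2 := by
  nlinarith [norm_nonneg z]

theorem poissonFactor_nonneg (ha : ‖a‖ < 1) (z : CN N) : 0 ≤ poissonFactor a z :=
  div_nonneg (one_sub_norm_sq_pos ha).le (sq_nonneg _)

/-- The normalizing constant of the weighted measure. -/
noncomputable def weightConst (N : ℕ) (s : ℝ) : ℝ :=
  Real.Gamma (N + s + 1) / (N.factorial * Real.Gamma (s + 1))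

theorem weightConst_pos {s : ℝ} (hs : -1 < s) : 0 < weightConst N s := by
  have h1 : 0 < Real.Gamma (s + 1) := Real.Gamma_pos_of_pos (by linarith)
  have h2 : 0 < Real.Gamma (N + s + 1) := Real.Gamma_pos_of_pos (by
    have : (0 : ℝ) ≤ N := N.cast_nonneg
    linarith)
  have h3 : (0 : ℝ) < N.factorial := by exact_mod_cast N.factorial_pos
  unfold weightConst
  positivity

theorem lintegral_weightedMeasure (s : ℝ) (h : CN N → ℝ≥0∞) :
    ∫⁻ z, h z ∂(weightedMeasure N s) = (volume (unitBall N))⁻¹ *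
      ∫⁻ z in unitBall N, ENNReal.ofReal (weightConst N s * (1 - ‖z‖ ^ 2) ^ s) * h z := by
  rw [weightedMeasure, lintegral_withDensity_eq_lintegral_mul_non_measurable₀]
  · rw [ballMeasure, lintegral_smul_measure, smul_eq_mul]
    rfl
  · have : Measurable fun z : CN N => ENNReal.ofReal (Real.Gamma (N + s + 1) /
      (N.factorial * Real.Gamma (s + 1)) * (1 - ‖z‖ ^ 2) ^ s) := by fun_prop
    exact this.aemeasurable
  · exact Eventually.of_forall fun z => ENNReal.ofReal_lt_top

theorem image_ballInvolution (ha : ‖a‖ < 1) : ballInvolution a '' unitBall N = unitBall N := by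
  refine (ballInvolution_mapsTo ha).image_subset.antisymm fun z hz =>
    ⟨_, ballInvolution_mapsTo ha hz, ballInvolution_ballInvolution ha
      (one_sub_herm_ne_zero (mem_ball_zero_iff.1 hz).le ha)⟩

/-- With `P` the Poisson factor, the real Jacobian is `P^(N+1)`, and `1-|φ_a(z)|² = P (1-|z|²)`
makes the weight contribute `P^s`. This is the origin of the exponent `t = N+s+1`. -/
theorem lintegral_comp_ballInvolution (ha : ‖a‖ < 1) (s : ℝ) (h : CN N → ℝ≥0∞) :
    ∫⁻ z, h (ballInvolution a z) ∂(weightedMeasure N s) =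
      ∫⁻ z, ENNReal.ofReal (poissonFactor a z ^ (N + s + 1)) * h z ∂(weightedMeasure N s) := by
  have hne : ∀ z ∈ unitBall N, 1 - herm z a ≠ 0 := fun z hz =>
    one_sub_herm_ne_zero (mem_ball_zero_iff.1 hz).le ha
  have hinv : ∀ z ∈ unitBall N, ballInvolution a (ballInvolution a z) = z := fun z hz =>
    ballInvolution_ballInvolution ha (hne z hz)
  rw [lintegral_weightedMeasure, lintegral_weightedMeasure]
  congr 1
  conv_lhs => rw [← image_ballInvolution (N := N) ha]
  rw [lintegral_image_eq_lintegral_abs_det_fderiv_mul volume measurableSet_ball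
    (fun z hz => ((hasFDerivAt_ballInvolution ha (hne z hz)).restrictScalars ℝ).hasFDerivWithinAt)
    (fun z hz w hw hzw => by rw [← hinv z hz, ← hinv w hw, hzw])]
  refine setLIntegral_congr_fun measurableSet_ball fun z hz => ?_
  have hz1 : ‖z‖ < 1 := mem_ball_zero_iff.1 hz
  have hP : 0 < poissonFactor a z := div_pos (one_sub_norm_sq_pos ha)
    (pow_pos (norm_pos_iff.2 (hne z hz)) 2)
  rw [hinv z hz, abs_det_ballInvolutionDeriv ha (hne z hz),
    one_sub_norm_sq_ballInvolution ha (hne z hz), ← mul_assoc, ← mul_assoc, mul_div_right_comm,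
    show (1 - ‖a‖ ^ 2) / ‖1 - herm z a‖ ^ 2 = poissonFactor a z from rfl,
    ← ENNReal.ofReal_mul (pow_nonneg hP.le _), ← ENNReal.ofReal_mul' (Real.rpow_nonneg hP.le _)]
  congr 2
  rw [Real.mul_rpow hP.le (one_sub_norm_sq_pos hz1).le,
    show (N : ℝ) + s + 1 = (N + 1 : ℕ) + s by push_cast; ring,
    Real.rpow_add hP, Real.rpow_natCast]
  ring

end BallSpaces

namespace BallSpaces

variable {N : ℕ}

/-! ### Polar coordinates -/

theorem setIntegral_Ioo_rpow_mul_one_sub_sq_rpow {p q : ℝ} (hp : 0 < p) (hq : 0 < q) :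
    ∫ r in Set.Ioo (0 : ℝ) 1, r ^ (2 * p - 1) * (1 - r ^ 2) ^ (q - 1) =
      2⁻¹ * (Real.Gamma p * Real.Gamma q / Real.Gamma (p + q)) := by
  have hbeta : ∫ x in Set.Ioo (0 : ℝ) 1, x ^ (p - 1) * (1 - x) ^ (q - 1) =
      Real.Gamma p * Real.Gamma q / Real.Gamma (p + q) := by
    have h1 := ProbabilityTheory.beta_eq_betaIntegralReal p q hp hq
    rw [ProbabilityTheory.beta] at h1
    have h2 : Complex.betaIntegral p q =
        ((∫ x in Set.Ioo (0 : ℝ) 1, x ^ (p - 1) * (1 - x) ^ (q - 1) : ℝ) : ℂ) := by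
      rw [Complex.betaIntegral, intervalIntegral.integral_of_le zero_le_one,
        integral_Ioc_eq_integral_Ioo, ← integral_complex_ofReal]
      refine setIntegral_congr_fun measurableSet_Ioo fun x hx => ?_
      rw [Complex.ofReal_mul, Complex.ofReal_cpow hx.1.le, Complex.ofReal_cpow (by linarith [hx.2])]
      push_cast
      rfl
    rw [h1, h2, Complex.ofReal_re]
  -- The substitution `x = r²` is made on the half-line, so the Beta integrand is cut off at `1`.
  set g : ℝ → ℝ := (Set.Iio 1).indicator fun x => x ^ (p - 1) * (1 - x) ^ (q - 1) with hg
  have h3 := integral_comp_rpow_Ioi_of_pos (g := g) (p := 2) two_pos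
  have h4 : ∫ x in Set.Ioi (0 : ℝ), g x = ∫ x in Set.Ioo (0 : ℝ) 1, x ^ (p - 1) * (1 - x) ^ (q - 1) := by
    rw [hg, setIntegral_indicator measurableSet_Iio, Set.Ioi_inter_Iio]
  have h5 : ∫ x in Set.Ioi (0 : ℝ), (2 * x ^ ((2 : ℝ) - 1)) • g (x ^ (2 : ℝ)) =
      2 * ∫ r in Set.Ioo (0 : ℝ) 1, r ^ (2 * p - 1) * (1 - r ^ 2) ^ (q - 1) := by
    rw [← Set.Ioi_inter_Iio, ← setIntegral_indicator measurableSet_Iio, ← integral_const_mul]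
    refine setIntegral_congr_fun measurableSet_Ioi fun x hx => ?_
    have hx0 : (0 : ℝ) < x := hx
    simp only [hg, Set.indicator_apply, Set.mem_Iio, Real.rpow_two, smul_eq_mul]
    have h6 : x ^ 2 < 1 ↔ x < 1 := by
      rw [sq_lt_one_iff₀ hx0.le]
    rw [if_congr h6 rfl rfl]
    split_ifs
    · rw [← Real.rpow_two, ← Real.rpow_mul hx0.le]
      have : x ^ (2 * p - 1) = x ^ ((2 : ℝ) - 1) * x ^ (2 * (p - 1)) := by
        rw [← Real.rpow_add hx0]
        ring_nf
      rw [this]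
      ring
    · simp
  rw [h5, h4, hbeta] at h3
  linarith

/-- Integration of a radial function times a homogeneous function in polar coordinates. -/
theorem setIntegral_ball_radial_smul_homogeneous (hN : 0 < N) (f : ℝ → ℝ) {G : CN N → ℂ} {d : ℕ}
    (hG : ∀ r : ℝ, 0 < r → ∀ z, G (r • z) = (r : ℂ) ^ d * G z) :
    ∫ z in unitBall N, (f ‖z‖ : ℂ) * G z =
      (∫ r in Set.Ioo (0 : ℝ) 1, r ^ (2 * N - 1 + d) * f r : ℝ) *
        ∫ ζ : sphere (0 : CN N) 1, G ζ ∂(volume : Measure (CN N)).toSphere := by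
  have : Nonempty (Fin N) := ⟨⟨0, hN⟩⟩
  have hdim : Module.finrank ℝ (CN N) = 2 * N := by
    rw [← Module.finrank_mul_finrank ℝ ℂ (CN N)]
    simp
  set μ : Measure (CN N) := volume with hμ
  -- The cut-off to the ball is absorbed into the radial factor, so that polar coordinates on the
  -- whole punctured space apply.
  set F : CN N → ℂ := fun z => (((Set.Iio (1 : ℝ)).indicator f ‖z‖ : ℝ) : ℂ) * G z with hF
  have h1 : ∫ z in unitBall N, (f ‖z‖ : ℂ) * G z ∂μ = ∫ z, F z ∂μ := by
    rw [← integral_indicator measurableSet_ball]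
    congr 1
    ext z
    by_cases hz : ‖z‖ < 1 <;> simp [hF, hz, Set.indicator]
  have h2 : ∫ z, F z ∂μ = ∫ x : ({(0)}ᶜ : Set (CN N)), F x.1 ∂(μ.comap (↑)) := by
    rw [integral_subtype_comap (measurableSet_singleton _).compl F, restrict_compl_singleton]
  have h3 : ∫ x : ({(0)}ᶜ : Set (CN N)), F x.1 ∂(μ.comap (↑)) =
      ∫ x : sphere (0 : CN N) 1 × Set.Ioi (0 : ℝ), G x.1 * (((Set.Iio (1 : ℝ)).indicator
        (fun r => r ^ d * f r) x.2 : ℝ) : ℂ) ∂μ.toSphere.prod (.volumeIoiPow (2 * N - 1)) := by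
    rw [← hdim, ← μ.measurePreserving_homeomorphUnitSphereProd.integral_comp
        (Homeomorph.measurableEmbedding _)]
    refine integral_congr_ae (Eventually.of_forall fun x => ?_)
    have hx : 0 < ‖x.1‖ := norm_pos_iff.2 x.2
    have h4 : G x.1 = (‖x.1‖ : ℂ) ^ d * G (‖x.1‖⁻¹ • x.1) := by
      rw [← hG _ hx, smul_smul, mul_inv_cancel₀ hx.ne', one_smul]
    simp only [hF, homeomorphUnitSphereProd_apply_snd_coe, homeomorphUnitSphereProd_apply_fst_coe]
    rw [h4, Set.indicator_apply, Set.indicator_apply]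
    split_ifs
    · push_cast
      ring
    · simp
  have h5 : ∫ x : Set.Ioi (0 : ℝ), (((Set.Iio (1 : ℝ)).indicator
        (fun r => r ^ d * f r) x : ℝ) : ℂ) ∂.volumeIoiPow (2 * N - 1) =
      (∫ r in Set.Ioo (0 : ℝ) 1, r ^ (2 * N - 1 + d) * f r : ℝ) := by
    simp only [Measure.volumeIoiPow, ENNReal.ofReal]
    rw [integral_withDensity_eq_integral_smul,
      integral_subtype_comap measurableSet_Ioi fun r : ℝ => Real.toNNReal (r ^ (2 * N - 1)) •
        (((Set.Iio (1 : ℝ)).indicator (fun r => r ^ d * f r) r : ℝ) : ℂ), ← Set.Ioi_inter_Iio,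
      ← setIntegral_indicator measurableSet_Iio, ← integral_complex_ofReal]
    · refine setIntegral_congr_fun measurableSet_Ioi fun r hr => ?_
      have hr0 : (0 : ℝ) < r := hr
      simp only [NNReal.smul_def, Real.coe_toNNReal _ (pow_nonneg hr0.le _), Set.indicator_apply]
      split_ifs
      · rw [Complex.real_smul, ← Complex.ofReal_mul, pow_add, mul_assoc]
      · simp
    · exact (measurable_subtype_coe.pow_const _).real_toNNReal
  rw [h1, h2, h3, integral_prod_mul (fun ζ : sphere (0 : CN N) 1 => G ζ)
    (fun r : Set.Ioi (0 : ℝ) => (((Set.Iio (1 : ℝ)).indicator (fun r => r ^ d * f r) r : ℝ) : ℂ)),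
    h5, mul_comm]

theorem integral_weightedMeasure {s : ℝ} (hs : -1 < s) (G : CN N → ℂ) :
    ∫ z, G z ∂(weightedMeasure N s) = (volume (unitBall N))⁻¹.toReal •
      ∫ z in unitBall N, ((weightConst N s * (1 - ‖z‖ ^ 2) ^ s : ℝ) : ℂ) * G z := by
  have hmeas : Measurable fun z : CN N => ENNReal.ofReal (Real.Gamma (N + s + 1) /
      (N.factorial * Real.Gamma (s + 1)) * (1 - ‖z‖ ^ 2) ^ s) := by fun_prop
  rw [weightedMeasure, integral_withDensity_eq_integral_toReal_smul hmeas
    (Eventually.of_forall fun z => ENNReal.ofReal_lt_top), ballMeasure, integral_smul_measure]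
  congr 1
  refine setIntegral_congr_fun measurableSet_ball fun z hz => ?_
  have hz1 : 0 < 1 - ‖z‖ ^ 2 := one_sub_norm_sq_pos (mem_ball_zero_iff.1 hz)
  have := weightConst_pos (N := N) hs
  change (ENNReal.ofReal (weightConst N s * (1 - ‖z‖ ^ 2) ^ s)).toReal • G z = _
  rw [ENNReal.toReal_ofReal (mul_nonneg this.le (Real.rpow_nonneg hz1.le _)), Complex.real_smul]

/-- The ratio of the integrals of a homogeneous function of degree `d` over the weighted ball and
over the sphere. -/
noncomputable def radialMoment (N : ℕ) (s : ℝ) (d : ℕ) : ℝ :=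
  Real.Gamma (N + d / 2) * Real.Gamma (N + s + 1) /
    (Real.Gamma N * Real.Gamma (N + d / 2 + s + 1))

/-- In polar coordinates the radial integral is a Beta integral with parameters `N + d/2` and `s +
1`. Scaling by positive reals suffices as hypothesis because the lemma is meant for `F * conj G` and
`|G|²`, which are not homogeneous over `ℂ`. -/
theorem integral_weightedMeasure_homogeneous (hN : 0 < N) {s : ℝ} (hs : -1 < s) {G : CN N → ℂ}
    {d : ℕ} (hG : ∀ r : ℝ, 0 < r → ∀ z, G (r • z) = (r : ℂ) ^ d * G z) :
    ∫ z, G z ∂(weightedMeasure N s) =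
      radialMoment N s d * ∫ ζ : sphere (0 : CN N) 1, G ζ ∂(sphereMeasure N) := by
  have : Nonempty (Fin N) := ⟨⟨0, hN⟩⟩
  have hN' : (0 : ℝ) < N := by exact_mod_cast hN
  have hdim : Module.finrank ℝ (CN N) = 2 * N := by
    rw [← Module.finrank_mul_finrank ℝ ℂ (CN N)]
    simp
  set V : ℝ := (volume (unitBall N)).toReal with hV
  have hV0 : V ≠ 0 := (ENNReal.toReal_pos (measure_ball_pos _ _ one_pos).ne' (measure_ball_lt_top.ne)).ne'
  rw [integral_weightedMeasure hs, sphereMeasure, integral_smul_measure,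
    Measure.toSphere_apply_univ, hdim]
  have h2 : ∫ r in Set.Ioo (0 : ℝ) 1, r ^ (2 * N - 1 + d) * (weightConst N s * (1 - r ^ 2) ^ s) =
      weightConst N s * (2⁻¹ * (Real.Gamma (N + d / 2) * Real.Gamma (s + 1) /
        Real.Gamma (N + d / 2 + (s + 1)))) := by
    rw [← setIntegral_Ioo_rpow_mul_one_sub_sq_rpow (by positivity) (by linarith),
      ← integral_const_mul]
    refine setIntegral_congr_fun measurableSet_Ioo fun r hr => ?_
    simp only [add_sub_cancel_right]
    rw [← Real.rpow_natCast r, mul_left_comm]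
    congr 3
    push_cast [Nat.cast_sub (by lia : 1 ≤ 2 * N)]
    ring
  rw [setIntegral_ball_radial_smul_homogeneous hN (fun r => weightConst N s * (1 - r ^ 2) ^ s) hG,
    h2, ENNReal.toReal_inv,
    ENNReal.toReal_inv, ENNReal.toReal_mul, ENNReal.toReal_natCast, ← hV]
  simp only [Complex.real_smul]
  rw [← mul_assoc, ← Complex.ofReal_mul, ← mul_assoc (radialMoment N s d : ℂ), ← Complex.ofReal_mul]
  congr 2
  have hf : (N.factorial : ℝ) = N * Real.Gamma N := by
    rw [← Real.Gamma_add_one hN'.ne', Real.Gamma_nat_eq_factorial]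
  have hg1 : Real.Gamma (s + 1) ≠ 0 := (Real.Gamma_pos_of_pos (by linarith)).ne'
  rw [radialMoment, weightConst, hf, ← add_assoc]
  push_cast
  field_simp

end BallSpaces

namespace BallSpaces

variable {N : ℕ}

/-! ### Homogeneous expansions -/

/-- `F` is homogeneous of degree `k`. -/
def IsHomogeneousFun (F : CN N → ℂ) (k : ℕ) : Prop := ∀ (c : ℂ) (z : CN N), F (c • z) = c ^ k * F z

theorem IsHomogeneousFun.const_mul {F : CN N → ℂ} {j : ℕ} (hF : IsHomogeneousFun F j) (b : ℂ) :
    IsHomogeneousFun (fun z => b * F z) j := fun c z => by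
  simp only [hF c z]
  ring

/-- `f = ∑ F k` on the closed unit ball, where `F k` is homogeneous of degree `k + m` and the series
converges normally. -/
structure HomogeneousExpansion (m : ℕ) (f : CN N → ℂ) (F : ℕ → CN N → ℂ) (c : ℕ → ℝ) : Prop where
  continuous : ∀ k, Continuous (F k)
  homogeneous : ∀ k, IsHomogeneousFun (F k) (k + m)
  bound : ∀ k z, ‖z‖ ≤ 1 → ‖F k z‖ ≤ c k
  summable : Summable c
  hasSum : ∀ z, ‖z‖ ≤ 1 → HasSum (fun k => F k z) (f z)

namespace HomogeneousExpansion

variable {m : ℕ} {f g : CN N → ℂ} {F G : ℕ → CN N → ℂ} {c d : ℕ → ℝ}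

theorem nonneg (h : HomogeneousExpansion m f F c) (k : ℕ) : 0 ≤ c k :=
  (norm_nonneg _).trans (h.bound k 0 (by simp))

theorem congr (h : HomogeneousExpansion m f F c) (hfg : ∀ z, g z = f z) :
    HomogeneousExpansion m g F c := by
  rwa [funext hfg]

theorem summable_norm (h : HomogeneousExpansion m f F c) {z : CN N} (hz : ‖z‖ ≤ 1) :
    Summable fun k => ‖F k z‖ :=
  Summable.of_nonneg_of_le (fun _ => norm_nonneg _) (fun k => h.bound k z hz) h.summable

/-- Cauchy product: the bounds are convolved along with the terms and stay summable. -/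
theorem mul (hf : HomogeneousExpansion 0 f F c) (hg : HomogeneousExpansion 0 g G d) :
    HomogeneousExpansion 0 (fun z => f z * g z)
      (fun n z => ∑ p ∈ Finset.HasAntidiagonal.antidiagonal n, F p.1 z * G p.2 z)
      (fun n => ∑ p ∈ Finset.HasAntidiagonal.antidiagonal n, c p.1 * d p.2) where
  continuous n := continuous_finsetSum _ fun p _ => (hf.continuous _).mul (hg.continuous _)
  homogeneous n a z := by
    rw [Finset.mul_sum]
    refine Finset.sum_congr rfl fun p hp => ?_
    rw [hf.homogeneous, hg.homogeneous, ← Finset.HasAntidiagonal.mem_antidiagonal.1 hp]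
    ring
  bound n z hz := by
    refine norm_sum_le_of_le _ fun p _ => ?_
    rw [norm_mul]
    exact mul_le_mul (hf.bound _ z hz) (hg.bound _ z hz) (norm_nonneg _) (hf.nonneg _)
  summable := summable_sum_mul_antidiagonal_of_summable_mul
    (hf.summable.mul_of_nonneg hg.summable hf.nonneg hg.nonneg)
  hasSum z hz := by
    have h1 := hf.summable_norm hz
    have h2 := hg.summable_norm hz
    have := (summable_norm_sum_mul_antidiagonal_of_summable_norm h1 h2).of_norm.hasSum
    rwa [← tsum_mul_tsum_eq_tsum_sum_antidiagonal_of_summable_norm h1 h2,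
      (hf.hasSum z hz).tsum_eq, (hg.hasSum z hz).tsum_eq] at this

theorem exists_const (b : ℂ) :
    ∃ (F : ℕ → CN N → ℂ) (c : ℕ → ℝ), HomogeneousExpansion 0 (fun _ => b) F c := by
  refine ⟨fun k _ => if k = 0 then b else 0, fun k => if k = 0 then ‖b‖ else 0, ?_, ?_, ?_, ?_, ?_⟩
  · exact fun k => continuous_const
  · intro k a z
    rcases eq_or_ne k 0 with rfl | hk <;> simp [*]
  · intro k z _
    split_ifs <;> simp
  · exact (hasSum_ite_eq 0 ‖b‖).summable
  · exact fun z _ => hasSum_ite_eq 0 b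

theorem exists_add_clm (b : ℂ) (L : CN N →L[ℂ] ℂ) :
    ∃ (F : ℕ → CN N → ℂ) (c : ℕ → ℝ), HomogeneousExpansion 0 (fun z => b + L z) F c := by
  refine ⟨fun k z => (if k = 0 then b else 0) + (if k = 1 then L z else 0),
    fun k => (if k = 0 then ‖b‖ else 0) + (if k = 1 then ‖L‖ else 0), ?_, ?_, ?_, ?_, ?_⟩
  · intro k
    split_ifs <;> fun_prop
  · intro k a z
    rcases eq_or_ne k 0 with rfl | hk
    · simp
    rcases eq_or_ne k 1 with rfl | hk1 <;> simp [*]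
  · intro k z hz
    refine norm_add_le_of_le ?_ ?_
    · split_ifs <;> simp
    · split_ifs
      · exact L.unit_le_opNorm z hz
      · simp
  · exact (hasSum_ite_eq 0 ‖b‖).summable.add (hasSum_ite_eq 1 ‖L‖).summable
  · exact fun z _ => (hasSum_ite_eq 0 b).add (hasSum_ite_eq 1 (L z))

theorem exists_pow (h : HomogeneousExpansion 0 f F c) (n : ℕ) :
    ∃ (G : ℕ → CN N → ℂ) (d : ℕ → ℝ), HomogeneousExpansion 0 (fun z => f z ^ n) G d := by
  induction n with
  | zero => simpa using exists_const (N := N) 1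
  | succ n ih =>
    obtain ⟨G, d, hG⟩ := ih
    exact ⟨_, _, by simpa only [pow_succ] using hG.mul h⟩

/-- Dilating an expansion by `r ∈ [0, 1]`. -/
theorem dilate (h : HomogeneousExpansion 0 f F c) {r : ℝ} (hr0 : 0 ≤ r) (hr1 : r ≤ 1) :
    HomogeneousExpansion 0 (fun z => f (r • z)) (fun k z => (r : ℂ) ^ k * F k z) c where
  continuous k := continuous_const.mul (h.continuous k)
  homogeneous k := (h.homogeneous k).const_mul _
  bound k z hz := by
    rw [norm_mul, norm_pow, Complex.norm_real, Real.norm_of_nonneg hr0]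
    calc r ^ k * ‖F k z‖ ≤ 1 * c k := by
          gcongr
          exacts [pow_le_one₀ hr0 hr1, h.bound k z hz]
      _ = c k := one_mul _
  summable := h.summable
  hasSum z hz := by
    have h1 : ‖r • z‖ ≤ 1 := by
      rw [norm_smul, Real.norm_of_nonneg hr0]
      exact mul_le_one₀ hr1 (norm_nonneg _) hz
    have h2 : ∀ k, F k (r • z) = (r : ℂ) ^ k * F k z := fun k => h.homogeneous k r z
    simpa only [h2] using h.hasSum _ h1

end HomogeneousExpansion

/-! ### Circular measures -/

/-- A finite measure carried by the closed unit ball for which homogeneous functions of different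
degrees are orthogonal. -/
structure IsCircularMeasure (μ : Measure (CN N)) : Prop where
  finite : IsFiniteMeasure μ
  ae_norm_le : ∀ᵐ z ∂μ, ‖z‖ ≤ 1
  orthogonal : ∀ (j k : ℕ) (F G : CN N → ℂ), IsHomogeneousFun F j → IsHomogeneousFun G k → j ≠ k →
    ∫ z, F z * starRingEnd ℂ (G z) ∂μ = 0

theorem IsCircularMeasure.integrable {μ : Measure (CN N)} (hμ : IsCircularMeasure μ)
    {E : Type*} [NormedAddCommGroup E] {f : CN N → E} (hf : AEStronglyMeasurable f μ) {C : ℝ}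
    (hC : ∀ z, ‖z‖ ≤ 1 → ‖f z‖ ≤ C) : Integrable f μ :=
  have := hμ.finite
  .of_bound hf C (hμ.ae_norm_le.mono hC)

/-- **Parseval's identity** for homogeneous expansions. -/
theorem HomogeneousExpansion.hasSum_integral_norm_sq {m : ℕ} {f : CN N → ℂ} {F : ℕ → CN N → ℂ}
    {c : ℕ → ℝ} (h : HomogeneousExpansion m f F c) {μ : Measure (CN N)}
    (hμ : IsCircularMeasure μ) :
    HasSum (fun k => ∫ z, ‖F k z‖ ^ 2 ∂μ) (∫ z, ‖f z‖ ^ 2 ∂μ) := by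
  have := hμ.finite
  -- `|f|²` is the double series of the `F j * conj (F k)`, dominated by the summable `c j * c k`,
  -- so it may be integrated termwise.
  set P : ℕ × ℕ → CN N → ℂ := fun p z => F p.1 z * starRingEnd ℂ (F p.2 z) with hP
  have hPb : ∀ p z, ‖z‖ ≤ 1 → ‖P p z‖ ≤ c p.1 * c p.2 := by
    intro p z hz
    rw [hP, norm_mul, RCLike.norm_conj]
    exact mul_le_mul (h.bound _ z hz) (h.bound _ z hz) (norm_nonneg _) (h.nonneg _)
  have hPc : ∀ p, Continuous (P p) := fun p =>
    (h.continuous _).mul (Complex.continuous_conj.comp (h.continuous _))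
  have hPi : ∀ p, Integrable (P p) μ := fun p =>
    hμ.integrable (hPc p).aestronglyMeasurable (hPb p)
  have hsum : Summable fun p => ∫ z, ‖P p z‖ ∂μ := by
    refine Summable.of_nonneg_of_le (fun p => integral_nonneg fun z => norm_nonneg _) (fun p => ?_)
      ((h.summable.mul_of_nonneg h.summable h.nonneg h.nonneg).mul_right (μ.real Set.univ))
    calc ∫ z, ‖P p z‖ ∂μ ≤ ∫ _, c p.1 * c p.2 ∂μ :=
          integral_mono_ae (hPi p).norm (integrable_const _) (hμ.ae_norm_le.mono (hPb p))
      _ = c p.1 * c p.2 * μ.real Set.univ := by simp [mul_comm]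
  have h1 := hasSum_integral_of_summable_integral_norm hPi hsum
  have h2 : ∫ z, ∑' p, P p z ∂μ = ((∫ z, ‖f z‖ ^ 2 ∂μ : ℝ) : ℂ) := by
    rw [← integral_complex_ofReal]
    refine integral_congr_ae (hμ.ae_norm_le.mono fun z hz => ?_)
    have h3 := h.summable_norm hz
    have h4 : Summable fun k => ‖starRingEnd ℂ (F k z)‖ := by simpa using h3
    have h5 := (Complex.hasSum_conj'.2 (h.hasSum z hz)).tsum_eq
    simp only [hP]
    rw [← tsum_mul_tsum_of_summable_norm h3 h4, (h.hasSum z hz).tsum_eq, h5, Complex.mul_conj']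
    push_cast
    rfl
  rw [h2] at h1
  -- Off-diagonal terms vanish by orthogonality, so the double sum collapses to the diagonal.
  have hdiag : Function.Injective fun k : ℕ => (k, k) := fun a b hab => (Prod.mk.inj hab).1
  rw [← hdiag.hasSum_iff] at h1
  · have h6 : ((fun p => ∫ z, P p z ∂μ) ∘ fun k : ℕ => (k, k)) =
        fun k => ((∫ z, ‖F k z‖ ^ 2 ∂μ : ℝ) : ℂ) := by
      ext k
      rw [← integral_complex_ofReal]
      refine integral_congr_ae (Eventually.of_forall fun z => ?_)
      simp only [hP, Complex.mul_conj']
      push_cast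
      rfl
    rw [h6] at h1
    exact_mod_cast h1
  · rintro ⟨j, k⟩ hjk
    refine hμ.orthogonal (j + m) (k + m) _ _ (h.homogeneous j) (h.homogeneous k) fun hjk' => hjk ?_
    exact ⟨j, by simp; lia⟩

/-! ### The weighted measures and the surface measure are circular -/

/-- The surface measure as a measure on `ℂ^N`. -/
noncomputable def surfaceMeasure (N : ℕ) : Measure (CN N) := (sphereMeasure N).map (↑)

theorem measurableEmbedding_sphere : MeasurableEmbedding ((↑) : sphere (0 : CN N) 1 → CN N) :=
  MeasurableEmbedding.subtype_coe isClosed_sphere.measurableSet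

theorem integral_surfaceMeasure {E : Type*} [NormedAddCommGroup E] [NormedSpace ℝ E]
    (G : CN N → E) : ∫ z, G z ∂(surfaceMeasure N) = ∫ ζ, G (ζ : CN N) ∂(sphereMeasure N) :=
  measurableEmbedding_sphere.integral_map G

theorem lintegral_surfaceMeasure (G : CN N → ℝ≥0∞) :
    ∫⁻ z, G z ∂(surfaceMeasure N) = ∫⁻ ζ, G (ζ : CN N) ∂(sphereMeasure N) :=
  measurableEmbedding_sphere.lintegral_map G

theorem isProbabilityMeasure_sphereMeasure (hN : 0 < N) :
    IsProbabilityMeasure (sphereMeasure N) := by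
  have : Nonempty (Fin N) := ⟨⟨0, hN⟩⟩
  refine ⟨?_⟩
  rw [sphereMeasure, Measure.smul_apply, smul_eq_mul]
  exact ENNReal.inv_mul_cancel (Measure.measure_univ_ne_zero.2 (Measure.toSphere_ne_zero _))
    (measure_ne_top _ _)

theorem isProbabilityMeasure_surfaceMeasure (hN : 0 < N) :
    IsProbabilityMeasure (surfaceMeasure N) :=
  have := isProbabilityMeasure_sphereMeasure hN
  Measure.isProbabilityMeasure_map measurableEmbedding_sphere.measurable.aemeasurable

theorem radialMoment_pos (hN : 0 < N) {s : ℝ} (hs : -1 < s) (d : ℕ) : 0 < radialMoment N s d := by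
  have hN' : (1 : ℝ) ≤ N := by exact_mod_cast hN
  have hd : (0 : ℝ) ≤ d / 2 := by positivity
  have h1 : 0 < Real.Gamma (N + d / 2) := Real.Gamma_pos_of_pos (by linarith)
  have h2 : 0 < Real.Gamma (N + s + 1) := Real.Gamma_pos_of_pos (by linarith)
  have h3 : 0 < Real.Gamma N := Real.Gamma_pos_of_pos (by linarith)
  have h4 : 0 < Real.Gamma (N + d / 2 + s + 1) := Real.Gamma_pos_of_pos (by linarith)
  unfold radialMoment
  positivity

theorem radialMoment_zero (hN : 0 < N) {s : ℝ} (hs : -1 < s) : radialMoment N s 0 = 1 := by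
  have hN' : (1 : ℝ) ≤ N := by exact_mod_cast hN
  have h2 : Real.Gamma (N + s + 1) ≠ 0 := (Real.Gamma_pos_of_pos (by linarith)).ne'
  have h3 : Real.Gamma N ≠ 0 := (Real.Gamma_pos_of_pos (by linarith)).ne'
  simp only [radialMoment, Nat.cast_zero, zero_div, add_zero]
  exact div_self (mul_ne_zero h3 h2)

theorem isProbabilityMeasure_weightedMeasure (hN : 0 < N) {s : ℝ} (hs : -1 < s) :
    IsProbabilityMeasure (weightedMeasure N s) := by
  have := isProbabilityMeasure_sphereMeasure hN
  have h := integral_weightedMeasure_homogeneous hN hs (G := fun _ => 1) (d := 0) (by simp)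
  rw [radialMoment_zero hN hs] at h
  simp only [integral_const, Complex.real_smul, mul_one, probReal_univ,
    Complex.ofReal_one] at h
  have h1 : (weightedMeasure N s).real Set.univ = 1 := by exact_mod_cast h
  refine ⟨?_⟩
  -- Real mass `1` also excludes infinite mass, whose `toReal` is `0`.
  rw [Measure.real, ENNReal.toReal_eq_one_iff] at h1
  exact h1

theorem ae_weightedMeasure (N : ℕ) (s : ℝ) : ∀ᵐ z ∂(weightedMeasure N s), z ∈ unitBall N := by
  refine (withDensity_absolutelyContinuous _ _).ae_le ?_
  exact Measure.smul_absolutelyContinuous.ae_le (ae_restrict_mem measurableSet_ball)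

theorem ae_surfaceMeasure (N : ℕ) : ∀ᵐ z ∂(surfaceMeasure N), ‖z‖ ≤ 1 :=
  measurableEmbedding_sphere.ae_map_iff.2 <| Eventually.of_forall fun ζ => by simp

theorem integral_weightedMeasure_comp_smul {s : ℝ} (hs : -1 < s) {c : ℂ} (hc : ‖c‖ = 1)
    (G : CN N → ℂ) :
    ∫ z, G (c • z) ∂(weightedMeasure N s) = ∫ z, G z ∂(weightedMeasure N s) := by
  have hc0 : c ≠ 0 := fun h => by simp [h] at hc
  rw [integral_weightedMeasure hs, integral_weightedMeasure hs]
  congr 1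
  set e : CN N ≃ₗᵢ[ℝ] CN N := ⟨(LinearEquiv.smulOfNeZero ℂ (CN N) c hc0).restrictScalars ℝ,
    fun z => by simp [norm_smul, hc]⟩ with he
  have he' : ∀ z, e z = c • z := fun z => rfl
  have := e.measurePreserving.setIntegral_preimage_emb e.toHomeomorph.measurableEmbedding
    (fun z => ((weightConst N s * (1 - ‖z‖ ^ 2) ^ s : ℝ) : ℂ) * G z) (unitBall N)
  have hpre : e ⁻¹' unitBall N = unitBall N := by
    ext z
    simp
  rw [hpre] at this
  simpa only [he', norm_smul, hc, one_mul] using this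

theorem isCircularMeasure_weightedMeasure (hN : 0 < N) {s : ℝ} (hs : -1 < s) :
    IsCircularMeasure (weightedMeasure N s) where
  finite := have := isProbabilityMeasure_weightedMeasure hN hs; inferInstance
  ae_norm_le := (ae_weightedMeasure N s).mono fun _ hz => (mem_ball_zero_iff.1 hz).le
  orthogonal j k F G hF hG hjk := by
    set I := ∫ z, F z * starRingEnd ℂ (G z) ∂(weightedMeasure N s) with hI
    have key : ∀ c : ℂ, ‖c‖ = 1 → c ^ j * starRingEnd ℂ c ^ k * I = I := by
      intro c hc
      conv_rhs => rw [hI, ← integral_weightedMeasure_comp_smul hs hc]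
      rw [hI, ← integral_const_mul]
      congr 1
      ext z
      rw [hF, hG, map_mul, map_pow]
      ring
    -- A single rotation is enough: `e^i` has infinite order because `π` is irrational.
    have h1 := key (Complex.exp (Complex.I)) (by simpa using Complex.norm_exp_ofReal_mul_I 1)
    by_contra h0
    have h2 : Complex.exp Complex.I ^ j * starRingEnd ℂ (Complex.exp Complex.I) ^ k = 1 :=
      mul_right_cancel₀ h0 (by rw [h1, one_mul])
    rw [← Complex.exp_conj, Complex.conj_I, ← Complex.exp_nat_mul, ← Complex.exp_nat_mul,
      ← Complex.exp_add, Complex.exp_eq_one_iff] at h2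
    obtain ⟨n, hn⟩ := h2
    have h3 : ((j : ℝ) - k : ℝ) = n * (2 * Real.pi) := by
      have : ((j : ℂ) - k) * Complex.I = (n * (2 * Real.pi)) * Complex.I := by
        linear_combination hn
      exact_mod_cast mul_right_cancel₀ Complex.I_ne_zero this
    have hn0 : n ≠ 0 := by
      rintro rfl
      apply hjk
      have : (j : ℝ) = k := by simpa [sub_eq_zero] using h3
      exact_mod_cast this
    refine irrational_pi ⟨((j : ℚ) - k) / (2 * n), ?_⟩
    have hn' : (n : ℝ) ≠ 0 := by exact_mod_cast hn0
    push_cast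
    rw [h3]
    field_simp

/-- `F * conj G` scales with degree `j + k` under positive reals, so its integral over the ball with
`s = 0` is a nonzero multiple of its integral over the sphere. -/
theorem isCircularMeasure_surfaceMeasure (hN : 0 < N) : IsCircularMeasure (surfaceMeasure N) where
  finite := have := isProbabilityMeasure_surfaceMeasure hN; inferInstance
  ae_norm_le := ae_surfaceMeasure N
  orthogonal j k F G hF hG hjk := by
    have h := (isCircularMeasure_weightedMeasure hN (s := 0) (by norm_num)).orthogonal j k F G
      hF hG hjk
    rw [integral_weightedMeasure_homogeneous hN (by norm_num) (d := j + k)] at h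
    · rw [integral_surfaceMeasure]
      refine (mul_eq_zero.1 h).resolve_left ?_
      exact_mod_cast (radialMoment_pos hN (by norm_num) _).ne'
    · intro r _ z
      have h1 : F (r • z) = (r : ℂ) ^ j * F z := hF r z
      have h2 : G (r • z) = (r : ℂ) ^ k * G z := hG r z
      rw [h1, h2, map_mul, map_pow, Complex.conj_ofReal]
      ring

end BallSpaces

namespace BallSpaces

variable {N : ℕ}

/-! ### The coefficients of `(1 - x)^(-t)` -/

/-- `Γ(t + k) / (k! Γ(t))`. -/
noncomputable def binomCoeff (t : ℝ) (k : ℕ) : ℝ :=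
  Real.Gamma (t + k) / (k.factorial * Real.Gamma t)

variable {t : ℝ}

theorem binomCoeff_pos (ht : 0 < t) (k : ℕ) : 0 < binomCoeff t k := by
  have h1 : 0 < Real.Gamma (t + k) := Real.Gamma_pos_of_pos (by positivity)
  have h2 : 0 < Real.Gamma t := Real.Gamma_pos_of_pos ht
  have h3 : (0 : ℝ) < k.factorial := by exact_mod_cast k.factorial_pos
  unfold binomCoeff
  positivity

theorem binomCoeff_zero (ht : 0 < t) : binomCoeff t 0 = 1 := by
  have h2 : Real.Gamma t ≠ 0 := (Real.Gamma_pos_of_pos ht).ne'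
  simp [binomCoeff, h2]

/-- Through this recursion, monotonicity and continuity in `t` become inductions on `k`. -/
theorem binomCoeff_succ (ht : 0 < t) (k : ℕ) :
    binomCoeff t (k + 1) = binomCoeff t k * ((t + k) / (k + 1)) := by
  have h1 : t + k ≠ 0 := by positivity
  have h3 : (k.factorial : ℝ) ≠ 0 := by exact_mod_cast k.factorial_ne_zero
  have h2 : Real.Gamma t ≠ 0 := (Real.Gamma_pos_of_pos ht).ne'
  rw [binomCoeff, binomCoeff, Nat.factorial_succ]
  push_cast
  rw [← add_assoc, Real.Gamma_add_one h1]
  field_simp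

theorem binomCoeff_mono {t' : ℝ} (ht : 0 < t) (htt : t ≤ t') (k : ℕ) :
    binomCoeff t k ≤ binomCoeff t' k := by
  have ht' := ht.trans_le htt
  induction k with
  | zero => rw [binomCoeff_zero ht, binomCoeff_zero ht']
  | succ k ih =>
    rw [binomCoeff_succ ht, binomCoeff_succ ht']
    have := (binomCoeff_pos ht' k).le
    gcongr

theorem tendsto_binomCoeff {ι : Type*} {l : Filter ι} {τ : ι → ℝ} (hτ : ∀ i, 0 < τ i) (ht : 0 < t)
    (h : Tendsto τ l (𝓝 t)) (k : ℕ) :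
    Tendsto (fun i => binomCoeff (τ i) k) l (𝓝 (binomCoeff t k)) := by
  induction k with
  | zero =>
    simp only [binomCoeff_zero ht, fun i => binomCoeff_zero (hτ i)]
    exact tendsto_const_nhds
  | succ k ih =>
    simp only [binomCoeff_succ ht, fun i => binomCoeff_succ (hτ i)]
    exact ih.mul ((h.add_const _).div_const _)

theorem tendsto_binomCoeff_div_succ (ht : 0 < t) :
    Tendsto (fun m => binomCoeff t m / binomCoeff t (m + 1)) atTop (𝓝 1) := by
  have h : ∀ m : ℕ, binomCoeff t m / binomCoeff t (m + 1) = 1 + (1 - t) / (m + t) := by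
    intro m
    have h1 := (binomCoeff_pos ht m).ne'
    have h2 : t + m ≠ 0 := by positivity
    have h3 : (m : ℝ) + t ≠ 0 := by positivity
    rw [binomCoeff_succ ht]
    field_simp
    ring
  simp only [h]
  have : Tendsto (fun m : ℕ => (1 - t) / ((m : ℝ) + t)) atTop (𝓝 0) :=
    tendsto_const_nhds.div_atTop (tendsto_atTop_add_const_right _ _ tendsto_natCast_atTop_atTop)
  simpa using this.const_add 1

theorem choose_eq_binomCoeff (ht : 0 < t) (k : ℕ) :
    Ring.choose ((t : ℂ) + k - 1) k = (binomCoeff t k : ℂ) := by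
  have h : ((k.factorial : ℂ)) * Ring.choose ((t : ℂ) + k - 1) k =
      k.factorial * (binomCoeff t k : ℂ) := by
    rw [show Ring.choose ((t : ℂ) + k - 1) k = Ring.multichoose (t : ℂ) k by
      rw [Ring.choose]; congr 1; ring, ← nsmul_eq_mul,
      Ring.factorial_nsmul_multichoose_eq_ascPochhammer, Polynomial.ascPochhammer_smeval_eq_eval]
    induction k with
    | zero => simp [binomCoeff_zero ht]
    | succ k ih =>
      rw [ascPochhammer_succ_eval, ih, binomCoeff_succ ht, Nat.factorial_succ]
      have : (k : ℂ) + 1 ≠ 0 := by exact_mod_cast k.succ_ne_zero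
      push_cast
      field_simp
  exact mul_left_cancel₀ (by exact_mod_cast k.factorial_ne_zero) h

theorem hasSum_binomCoeff (ht : 0 < t) {z : ℂ} (hz : ‖z‖ < 1) :
    HasSum (fun k => (binomCoeff t k : ℂ) * z ^ k) (1 / (1 - z) ^ (t : ℂ)) := by
  have h := (Complex.one_div_one_sub_cpow_hasFPowerSeriesOnBall_zero (t : ℂ)).hasSum
    (y := z) (by simpa [← ofReal_norm] using hz)
  rw [zero_add] at h
  simpa only [FormalMultilinearSeries.ofScalars_apply_eq, smul_eq_mul, choose_eq_binomCoeff ht]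
    using h

theorem summable_binomCoeff_mul_pow (ht : 0 < t) {x : ℝ} (hx0 : 0 ≤ x) (hx : x < 1) :
    Summable fun k => binomCoeff t k * x ^ k := by
  have h := (hasSum_binomCoeff ht (z := (x : ℂ))
    (by rwa [Complex.norm_real, Real.norm_of_nonneg hx0])).summable
  exact_mod_cast h

theorem hasSum_binomCoeff_real (ht : 0 < t) {x : ℝ} (hx0 : 0 ≤ x) (hx : x < 1) :
    HasSum (fun k => binomCoeff t k * x ^ k) (((1 - x) ^ t)⁻¹) := by
  have h := hasSum_binomCoeff ht (z := (x : ℂ))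
    (by rwa [Complex.norm_real, Real.norm_of_nonneg hx0])
  rw [one_div, ← Complex.ofReal_one, ← Complex.ofReal_sub, ← Complex.ofReal_cpow (by linarith),
    ← Complex.ofReal_inv] at h
  exact_mod_cast h

theorem summable_binomCoeff_sq_mul_pow (ht : 0 < t) {x : ℝ} (hx0 : 0 ≤ x) (hx : x < 1) :
    Summable fun k => binomCoeff t k ^ 2 * x ^ (2 * k) := by
  have h := summable_binomCoeff_mul_pow ht hx0 hx
  have h0 : ∀ k, 0 ≤ binomCoeff t k * x ^ k := fun k =>
    mul_nonneg (binomCoeff_pos ht k).le (pow_nonneg hx0 k)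
  have h1 := h.mul_of_nonneg h h0 h0
  refine (h1.comp_injective (i := fun k : ℕ => (k, k)) fun a b hab => (Prod.mk.inj hab).1).congr
    fun k => ?_
  simp only [Function.comp_apply]
  ring

/-- A power series vanishing on `(0, 1)` is zero. -/
theorem eq_zero_of_hasSum_mul_pow_zero {c : ℕ → ℝ}
    (h : ∀ x ∈ Set.Ioo (0 : ℝ) 1, HasSum (fun k => c k * x ^ k) 0) : c = 0 := by
  set p := FormalMultilinearSeries.ofScalars ℝ c with hp
  have hr : 0 < p.radius := by
    refine lt_of_lt_of_le ?_ (p.le_radius_of_summable_norm (r := 1 / 2) ?_)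
    · simp
    · have := (h (1 / 2) (by norm_num)).summable.norm
      refine this.congr fun k => ?_
      rw [hp, FormalMultilinearSeries.ofScalars_norm, norm_mul]
      simp
  have hps := (p.hasFPowerSeriesOnBall hr).hasFPowerSeriesAt
  have hsum : ∀ x ∈ Set.Ioo (0 : ℝ) 1, p.sum x = 0 := fun x hx => by
    have := FormalMultilinearSeries.ofScalars_sum_eq c x
    rw [FormalMultilinearSeries.ofScalarsSum] at this
    rw [hp, this]
    simpa using (h x hx).tsum_eq
  have hev : ∀ᶠ x in 𝓝 (0 : ℝ), p.sum x = 0 := by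
    -- Identity principle: the zeros in `(0, 1)` accumulate at `0`.
    refine hps.analyticAt.frequently_zero_iff_eventually_zero.1 ?_
    have h1 : ∃ᶠ x in 𝓝[>] (0 : ℝ), p.sum x = 0 :=
      (Filter.eventually_of_mem (Ioo_mem_nhdsGT one_pos) hsum).frequently
    exact h1.filter_mono (nhdsWithin_mono _ fun x hx => ne_of_gt hx)
  have := (hps.congr hev).eq_zero
  exact (FormalMultilinearSeries.ofScalars_series_eq_zero ℝ).1 this

theorem radialMoment_two_mul (hN : 0 < N) {s : ℝ} (hs : -1 < s) (k : ℕ) :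
    radialMoment N s (2 * k) = binomCoeff N k / binomCoeff (N + s + 1) k := by
  have hN' : (1 : ℝ) ≤ N := by exact_mod_cast hN
  have h2 : Real.Gamma (N + s + 1) ≠ 0 := (Real.Gamma_pos_of_pos (by linarith)).ne'
  have h3 : Real.Gamma N ≠ 0 := (Real.Gamma_pos_of_pos (by linarith)).ne'
  have h4 : (k.factorial : ℝ) ≠ 0 := by exact_mod_cast k.factorial_ne_zero
  have h5 : ((2 * k : ℕ) : ℝ) / 2 = k := by push_cast; ring
  rw [radialMoment, binomCoeff, binomCoeff, h5,
    show (N : ℝ) + k + s + 1 = N + s + 1 + k by ring]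
  field_simp

/-! ### Moments -/

/-- The norm squared of `⟨z, u⟩^m ⟨z, a⟩^k` in `L²(μ)`. -/
noncomputable def pairMoment (μ : Measure (CN N)) (u a : CN N) (m k : ℕ) : ℝ :=
  ∫ z, ‖herm z u‖ ^ (2 * m) * ‖herm z a‖ ^ (2 * k) ∂μ

/-- `(1 - ⟨z, a⟩)^(-t)`. -/
noncomputable def ballKernel (t : ℝ) (a z : CN N) : ℂ := 1 / (1 - herm z a) ^ (t : ℂ)

variable {a u : CN N}

theorem norm_herm_le_one (hu : ‖u‖ ≤ 1) {z : CN N} (hz : ‖z‖ ≤ 1) : ‖herm z u‖ ≤ 1 :=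
  (norm_herm_le z u).trans (mul_le_one₀ hz (norm_nonneg _) hu)

theorem norm_herm_le_right (a : CN N) {z : CN N} (hz : ‖z‖ ≤ 1) : ‖herm z a‖ ≤ ‖a‖ :=
  (norm_herm_le z a).trans (mul_le_of_le_one_left (norm_nonneg _) hz)

/-- The binomial series times a factor of degree `m`, whence the degree offset in
`HomogeneousExpansion`. -/
theorem homogeneousExpansion_ballKernel (ht : 0 < t) (hu : ‖u‖ ≤ 1) (ha : ‖a‖ < 1) (m : ℕ) :
    HomogeneousExpansion m (fun z => herm z u ^ m * ballKernel t a z)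
      (fun k z => herm z u ^ m * (binomCoeff t k * herm z a ^ k))
      (fun k => binomCoeff t k * ‖a‖ ^ k) where
  continuous k := by fun_prop
  homogeneous k c z := by
    simp only [herm_smul_left]
    ring
  bound k z hz := by
    rw [norm_mul, norm_mul, norm_pow, norm_pow, Complex.norm_real,
      Real.norm_of_nonneg (binomCoeff_pos ht k).le]
    have h1 := norm_herm_le_one hu hz
    have h2 := norm_herm_le_right a hz
    have h3 := (binomCoeff_pos ht k).le
    calc ‖herm z u‖ ^ m * (binomCoeff t k * ‖herm z a‖ ^ k)
        ≤ 1 * (binomCoeff t k * ‖a‖ ^ k) := by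
          gcongr
          exact pow_le_one₀ (norm_nonneg _) h1
      _ = _ := one_mul _
  summable := summable_binomCoeff_mul_pow ht (norm_nonneg a) ha
  hasSum z hz := (hasSum_binomCoeff ht ((norm_herm_le_right a hz).trans_lt ha)).mul_left _

theorem hasSum_pairMoment (ht : 0 < t) (hu : ‖u‖ ≤ 1) (ha : ‖a‖ < 1) (m : ℕ)
    {μ : Measure (CN N)} (hμ : IsCircularMeasure μ) :
    HasSum (fun k => binomCoeff t k ^ 2 * pairMoment μ u a m k)
      (∫ z, ‖herm z u ^ m * ballKernel t a z‖ ^ 2 ∂μ) := by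
  refine ((homogeneousExpansion_ballKernel ht hu ha m).hasSum_integral_norm_sq hμ).congr_fun
    fun k => ?_
  rw [pairMoment, ← integral_const_mul]
  congr 1
  ext z
  rw [norm_mul, norm_mul, norm_pow, norm_pow, Complex.norm_real, Real.norm_eq_abs, mul_pow, mul_pow,
    sq_abs]
  ring

theorem poissonFactor_rpow (ha : ‖a‖ < 1) (z : CN N) :
    poissonFactor a z ^ t = (1 - ‖a‖ ^ 2) ^ t * ‖ballKernel t a z‖ ^ 2 := by
  have h : (‖1 - herm z a‖ ^ 2) ^ t = (‖1 - herm z a‖ ^ t) ^ 2 := by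
    rw [← Real.rpow_natCast, ← Real.rpow_natCast, ← Real.rpow_mul (norm_nonneg _),
      ← Real.rpow_mul (norm_nonneg _), mul_comm]
  rw [poissonFactor, Real.div_rpow (one_sub_norm_sq_pos ha).le (sq_nonneg _), h, ballKernel,
    norm_div, norm_one, Complex.norm_cpow_real, div_eq_mul_inv, one_div, inv_pow]

theorem measurable_herm_left (a : CN N) : Measurable fun z : CN N => herm z a :=
  (continuous_herm_left a).measurable

theorem measurable_ballKernel (t : ℝ) (a : CN N) : Measurable (ballKernel t a) :=
  (((measurable_herm_left a).const_sub 1).pow_const _).const_div 1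

theorem pairMoment_zero_right (μ : Measure (CN N)) (u a : CN N) (m : ℕ) :
    pairMoment μ u a m 0 = ∫ z, ‖herm z u‖ ^ (2 * m) ∂μ := by
  simp [pairMoment]

/-- The change of variables applied to the constant `1`. -/
theorem integral_norm_ballKernel_sq (hN : 0 < N) {s : ℝ} (hs : -1 < s) (ha : ‖a‖ < 1) :
    (1 - ‖a‖ ^ 2) ^ (N + s + 1) * ∫ z, ‖ballKernel (N + s + 1) a z‖ ^ 2 ∂(weightedMeasure N s) =
      1 := by
  have := isProbabilityMeasure_weightedMeasure hN hs
  have h := lintegral_comp_ballInvolution ha s fun _ => 1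
  simp only [lintegral_const, measure_univ, mul_one, poissonFactor_rpow ha] at h
  rw [← integral_const_mul, integral_eq_lintegral_of_nonneg_ae, ← h, ENNReal.toReal_one]
  · refine Eventually.of_forall fun z => ?_
    have := Real.rpow_nonneg (one_sub_norm_sq_pos ha).le (N + s + 1)
    simp only [Pi.zero_apply]
    positivity
  · exact (((measurable_ballKernel _ a).norm.pow_const 2).const_mul _).aestronglyMeasurable

/-- This is `‖e_k‖ = 1`. For `b = √x u`, Parseval and `integral_norm_ballKernel_sq` evaluate the
kernel norm as `∑ b_k² n_k x^k = (1-x)^(-t) = ∑ b_k x^k`, with `n_k` the moments; comparing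
coefficients gives `b_k n_k = 1`. -/
theorem binomCoeff_mul_integral_weightedMeasure (hN : 0 < N) {s : ℝ} (hs : -1 < s) (hu : ‖u‖ = 1)
    (k : ℕ) :
    binomCoeff (N + s + 1) k * ∫ z, ‖herm z u‖ ^ (2 * k) ∂(weightedMeasure N s) = 1 := by
  set t : ℝ := N + s + 1 with ht'
  have hN' : (1 : ℝ) ≤ N := by exact_mod_cast hN
  have ht : 0 < t := by linarith
  have hμ := isCircularMeasure_weightedMeasure hN hs
  set n : ℕ → ℝ := fun k => ∫ z, ‖herm z u‖ ^ (2 * k) ∂(weightedMeasure N s) with hn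
  have key : (fun k => binomCoeff t k ^ 2 * n k - binomCoeff t k) = 0 := by
    refine eq_zero_of_hasSum_mul_pow_zero fun x hx => ?_
    set ρ : ℝ := √x with hρ
    have hρ2 : ρ ^ 2 = x := Real.sq_sqrt hx.1.le
    have hρ0 : 0 ≤ ρ := Real.sqrt_nonneg x
    set b : CN N := (ρ : ℂ) • u with hb
    have hbn : ‖b‖ = ρ := by
      rw [hb, norm_smul, Complex.norm_real, Real.norm_of_nonneg hρ0, hu, mul_one]
    have hb1 : ‖b‖ < 1 := by
      rw [hbn]
      nlinarith [hx.2]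
    have h1 := hasSum_pairMoment ht hu.le hb1 0 hμ
    have h2 := integral_norm_ballKernel_sq hN hs hb1
    have h3 : ∀ k, pairMoment (weightedMeasure N s) u b 0 k = n k * x ^ k := by
      intro k
      rw [pairMoment, hn, ← integral_mul_const]
      congr 1
      ext z
      rw [hb, herm_smul_right, norm_mul, Complex.conj_ofReal, Complex.norm_real,
        Real.norm_of_nonneg hρ0, mul_pow, pow_mul ρ, hρ2]
      ring
    simp only [pow_zero, one_mul, h3] at h1
    rw [hbn, hρ2] at h2
    have hpos : 0 < (1 - x) ^ t := Real.rpow_pos_of_pos (by linarith [hx.2]) _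
    rw [eq_inv_of_mul_eq_one_right h2] at h1
    have h4 := h1.sub (hasSum_binomCoeff_real ht hx.1.le hx.2)
    rw [sub_self] at h4
    refine h4.congr_fun fun k => ?_
    ring
  have h5 := congrFun key k
  simp only [Pi.zero_apply] at h5
  have h6 := (binomCoeff_pos ht k).ne'
  have : binomCoeff t k * (binomCoeff t k * n k - 1) = 0 := by linear_combination h5
  linarith [(mul_eq_zero.1 this).resolve_left h6]

theorem binomCoeff_mul_integral_surfaceMeasure (hN : 0 < N) (hu : ‖u‖ = 1) (k : ℕ) :
    binomCoeff N k * ∫ z, ‖herm z u‖ ^ (2 * k) ∂(surfaceMeasure N) = 1 := by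
  have hs : (-1 : ℝ) < 0 := by norm_num
  have hN' : (0 : ℝ) < N := by exact_mod_cast hN
  have h1 := binomCoeff_mul_integral_weightedMeasure hN hs hu k
  have h2 := integral_weightedMeasure_homogeneous hN hs (d := 2 * k)
    (G := fun z => ((‖herm z u‖ ^ (2 * k) : ℝ) : ℂ)) (fun r hr z => by
      have : herm (r • z) u = r * herm z u := herm_smul_left (r : ℂ) z u
      rw [this, norm_mul, Complex.norm_real, Real.norm_of_nonneg hr.le]
      push_cast
      ring)
  rw [integral_complex_ofReal, integral_complex_ofReal, ← Complex.ofReal_mul,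
    Complex.ofReal_inj, radialMoment_two_mul hN hs] at h2
  rw [integral_surfaceMeasure]
  rw [h2] at h1
  have h3 : binomCoeff ((N : ℝ) + 0 + 1) k ≠ 0 := (binomCoeff_pos (by linarith) k).ne'
  field_simp at h1
  exact h1

end BallSpaces

namespace BallSpaces

variable {N : ℕ} {a u : CN N} {t : ℝ}

/-! ### Concentration -/

theorem continuous_pairMoment_integrand (u a : CN N) (m k : ℕ) :
    Continuous fun z : CN N => ‖herm z u‖ ^ (2 * m) * ‖herm z a‖ ^ (2 * k) := by
  fun_prop

theorem integrable_pairMoment_integrand {μ : Measure (CN N)} (hμ : IsCircularMeasure μ)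
    (u a : CN N) (m k : ℕ) :
    Integrable (fun z => ‖herm z u‖ ^ (2 * m) * ‖herm z a‖ ^ (2 * k)) μ :=
  hμ.integrable (continuous_pairMoment_integrand u a m k).aestronglyMeasurable
    (C := ‖u‖ ^ (2 * m) * ‖a‖ ^ (2 * k)) fun z hz => by
      rw [Real.norm_of_nonneg (by positivity)]
      have h1 := norm_herm_le_right u hz
      have h2 := norm_herm_le_right a hz
      gcongr

theorem pairMoment_nonneg (μ : Measure (CN N)) (u a : CN N) (m k : ℕ) : 0 ≤ pairMoment μ u a m k :=
  integral_nonneg fun z => by positivity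

theorem pairMoment_le {μ : Measure (CN N)} (hμ : IsCircularMeasure μ) (u a : CN N) (m k : ℕ) :
    pairMoment μ u a m k ≤ pairMoment μ u a m 0 * ‖a‖ ^ (2 * k) := by
  rw [pairMoment, pairMoment, ← integral_mul_const]
  refine integral_mono_ae (integrable_pairMoment_integrand hμ u a m k)
    ((integrable_pairMoment_integrand hμ u a m 0).mul_const _) (hμ.ae_norm_le.mono fun z hz => ?_)
  have h2 := norm_herm_le_right a hz
  simp only [mul_zero, pow_zero, mul_one]
  gcongr

/-- Split `z = h u + w` with `w ⊥ u`. Both `|w|` and `1 - |h|` are at most `y = √(1-|h|²)`, so the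
difference is at most `2y ≤ ε + ε⁻¹ y²`. The last form is affine in `|h|²`, so integrating it
against `|h|^(2m)` produces only two consecutive moments. -/
theorem abs_norm_herm_sub_le (hu : ‖u‖ = 1) (ha : ‖a‖ ≤ 1) {z : CN N} (hz : ‖z‖ ≤ 1) {ε : ℝ}
    (hε : 0 < ε) :
    |‖herm z a‖ - ‖herm u a‖| ≤ ε + ε⁻¹ * (1 - ‖herm z u‖ ^ 2) := by
  set h := herm z u with hh
  have hh1 : ‖h‖ ≤ 1 := norm_herm_le_one hu.le hz
  have hq : ‖herm u a‖ ≤ 1 := norm_herm_le_one ha hu.le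
  set w := z - h • u with hw
  have hz' : z = h • u + w := by simp [hw]
  have hwn : ‖w‖ ^ 2 = ‖z‖ ^ 2 - ‖h‖ ^ 2 := by
    have : (‖w‖ : ℂ) ^ 2 = (‖z‖ : ℂ) ^ 2 - (‖h‖ : ℂ) ^ 2 := by
      rw [← herm_self w, hw]
      simp only [herm_sub_left, herm_sub_right, herm_smul_left, herm_smul_right]
      rw [herm_comm u z, ← hh, herm_self, herm_self, hu, ← Complex.mul_conj' h]
      push_cast
      ring
    exact_mod_cast this
  have hp : herm z a = h * herm u a + herm w a := by
    conv_lhs => rw [hz', herm_add_left, herm_smul_left]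
  have h1 : |‖herm z a‖ - ‖h * herm u a‖| ≤ ‖w‖ := by
    refine (abs_norm_sub_norm_le _ _).trans ?_
    rw [hp, add_sub_cancel_left]
    exact (norm_herm_le w a).trans (mul_le_of_le_one_right (norm_nonneg _) ha)
  have hw2 : ‖w‖ ^ 2 ≤ 1 - ‖h‖ ^ 2 := by
    rw [hwn]
    nlinarith [norm_nonneg z]
  set y := √(1 - ‖h‖ ^ 2) with hy
  have hy0 : 0 ≤ y := Real.sqrt_nonneg _
  have hy2 : y ^ 2 = 1 - ‖h‖ ^ 2 := Real.sq_sqrt (by nlinarith [norm_nonneg h])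
  have hwy : ‖w‖ ≤ y := Real.le_sqrt_of_sq_le hw2
  have hhy : 1 - ‖h‖ ≤ y := by
    have hy1 : y ≤ 1 := by nlinarith [norm_nonneg h]
    nlinarith [norm_nonneg h]
  have h2 : |‖h * herm u a‖ - ‖herm u a‖| ≤ y := by
    rw [norm_mul, abs_le]
    constructor <;> nlinarith [norm_nonneg h, norm_nonneg (herm u a)]
  have h3 : 2 * y ≤ ε + ε⁻¹ * (1 - ‖h‖ ^ 2) := by
    rw [← hy2]
    have h4 : 0 ≤ ε⁻¹ * (ε - y) ^ 2 := by positivity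
    have h5 : ε⁻¹ * (ε - y) ^ 2 = ε + ε⁻¹ * y ^ 2 - 2 * y := by
      field_simp
      ring
    linarith
  calc |‖herm z a‖ - ‖herm u a‖| ≤ |‖herm z a‖ - ‖h * herm u a‖| + |‖h * herm u a‖ - ‖herm u a‖| :=
        abs_sub_le _ _ _
    _ ≤ ‖w‖ + y := add_le_add h1 h2
    _ ≤ _ := by linarith

theorem abs_pow_sub_pow_le_of_le_one {x y : ℝ} (hx0 : 0 ≤ x) (hx : x ≤ 1) (hy0 : 0 ≤ y)
    (hy : y ≤ 1) (n : ℕ) : |x ^ n - y ^ n| ≤ n * |x - y| := by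
  refine (abs_pow_sub_pow_le x y n).trans ?_
  rw [abs_of_nonneg hx0, abs_of_nonneg hy0]
  have : max x y ^ (n - 1) ≤ 1 := pow_le_one₀ (le_max_of_le_left hx0) (max_le hx hy)
  calc |x - y| * n * max x y ^ (n - 1) ≤ |x - y| * n * 1 := by gcongr
    _ = n * |x - y| := by ring

/-- The probability measures `b m |⟨z, u⟩|^(2m) dμ` concentrate on the circle through `u`. -/
theorem tendsto_mul_pairMoment {μ : Measure (CN N)} (hμ : IsCircularMeasure μ) (hu : ‖u‖ = 1)
    (ha : ‖a‖ ≤ 1) {b : ℕ → ℝ} (hb0 : ∀ m, 0 < b m)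
    (hb : ∀ m, b m * ∫ z, ‖herm z u‖ ^ (2 * m) ∂μ = 1)
    (hlim : Tendsto (fun m => b m / b (m + 1)) atTop (𝓝 1)) (k : ℕ) :
    Tendsto (fun m => b m * pairMoment μ u a m k) atTop (𝓝 (‖herm u a‖ ^ (2 * k))) := by
  have hI : ∀ m, Integrable (fun z => ‖herm z u‖ ^ (2 * m)) μ := fun m => by
    simpa using integrable_pairMoment_integrand hμ u a m 0
  have key : ∀ ε : ℝ, 0 < ε → ∀ m, |b m * pairMoment μ u a m k - ‖herm u a‖ ^ (2 * k)| ≤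
      (2 * k : ℕ) * (ε + ε⁻¹ * (1 - b m / b (m + 1))) := by
    intro ε hε m
    have h1 : b m * pairMoment μ u a m k - ‖herm u a‖ ^ (2 * k) =
        b m * ∫ z, ‖herm z u‖ ^ (2 * m) * (‖herm z a‖ ^ (2 * k) - ‖herm u a‖ ^ (2 * k)) ∂μ := by
      simp only [mul_sub]
      rw [integral_sub (integrable_pairMoment_integrand hμ u a m k) ((hI m).mul_const _),
        integral_mul_const, mul_sub, ← mul_assoc (b m), hb, one_mul, pairMoment]
    have h2 : ‖∫ z, ‖herm z u‖ ^ (2 * m) * (‖herm z a‖ ^ (2 * k) - ‖herm u a‖ ^ (2 * k)) ∂μ‖ ≤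
        ∫ z, (2 * k : ℕ) * ((ε + ε⁻¹) * ‖herm z u‖ ^ (2 * m) -
          ε⁻¹ * ‖herm z u‖ ^ (2 * (m + 1))) ∂μ := by
      refine norm_integral_le_of_norm_le
        ((((hI m).const_mul _).sub ((hI (m + 1)).const_mul _)).const_mul _)
        (hμ.ae_norm_le.mono fun z hz => ?_)
      have h3 := abs_norm_herm_sub_le hu ha hz hε
      have h4 := abs_pow_sub_pow_le_of_le_one (norm_nonneg (herm z a)) (norm_herm_le_one ha hz)
        (norm_nonneg (herm u a)) (norm_herm_le_one ha hu.le) (2 * k)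
      rw [norm_mul, Real.norm_of_nonneg (by positivity), Real.norm_eq_abs]
      calc ‖herm z u‖ ^ (2 * m) * |‖herm z a‖ ^ (2 * k) - ‖herm u a‖ ^ (2 * k)|
          ≤ ‖herm z u‖ ^ (2 * m) * ((2 * k : ℕ) * (ε + ε⁻¹ * (1 - ‖herm z u‖ ^ 2))) := by
            gcongr
            exact h4.trans (by gcongr)
        _ = _ := by ring
    have h5 : b m * ∫ z, (2 * k : ℕ) * ((ε + ε⁻¹) * ‖herm z u‖ ^ (2 * m) -
          ε⁻¹ * ‖herm z u‖ ^ (2 * (m + 1))) ∂μ =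
          (2 * k : ℕ) * (ε + ε⁻¹ * (1 - b m / b (m + 1))) := by
      rw [integral_const_mul, integral_sub ((hI m).const_mul _) ((hI (m + 1)).const_mul _),
        integral_const_mul, integral_const_mul, eq_inv_of_mul_eq_one_right (hb m),
        eq_inv_of_mul_eq_one_right (hb (m + 1))]
      have := (hb0 m).ne'
      have := (hb0 (m + 1)).ne'
      field_simp
      ring
    rw [h1, abs_mul, abs_of_pos (hb0 m), ← h5]
    exact mul_le_mul_of_nonneg_left h2 (hb0 m).le
  rw [Metric.tendsto_atTop]
  intro δ hδ
  -- The final bound is `2k (ε + ε) < (4k + 4) ε = δ`; asking the ratio to be within `ε²` of `1`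
  -- makes the second summand at most `ε`.
  set ε : ℝ := δ / (4 * k + 4) with hεdef
  have hε : 0 < ε := by positivity
  obtain ⟨M, hM⟩ := (Metric.tendsto_atTop.1 hlim) (ε ^ 2) (by positivity)
  refine ⟨M, fun m hm => ?_⟩
  have h1 := hM m hm
  rw [Real.dist_eq, abs_lt] at h1
  rw [Real.dist_eq]
  have h2 : ε⁻¹ * (1 - b m / b (m + 1)) ≤ ε := by
    rw [inv_mul_le_iff₀ hε]
    nlinarith [h1.1]
  calc |b m * pairMoment μ u a m k - ‖herm u a‖ ^ (2 * k)|
      ≤ (2 * k : ℕ) * (ε + ε⁻¹ * (1 - b m / b (m + 1))) := key ε hε m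
    _ ≤ (2 * k : ℕ) * (ε + ε) := by gcongr
    _ < (4 * k + 4) * ε := by push_cast; linarith
    _ = δ := by rw [hεdef]; field_simp

theorem summable_pairMoment_bound (ht : 0 < t) (ha : ‖a‖ < 1) :
    Summable fun k => binomCoeff t k ^ 2 * ‖a‖ ^ (2 * k) :=
  summable_binomCoeff_sq_mul_pow ht (norm_nonneg a) ha

/-- Dominated convergence: since `b_m` normalizes the zeroth moment, `b_k² |a|^(2k)` is a majorant
independent of `m`. -/
theorem exists_tendsto_tsum_pairMoment {μ : Measure (CN N)} (hμ : IsCircularMeasure μ)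
    (hu : ‖u‖ = 1) (ht : 0 < t) (ha : ‖a‖ < 1)
    (hb : ∀ m, binomCoeff t m * ∫ z, ‖herm z u‖ ^ (2 * m) ∂μ = 1) :
    ∃ L : ℝ, Tendsto (fun m => binomCoeff t m *
        ((1 - ‖a‖ ^ 2) ^ t * ∑' k, binomCoeff t k ^ 2 * pairMoment μ u a m k)) atTop (𝓝 L) ∧
      L ≤ (1 - ‖a‖ ^ 2) ^ t * ∑' k, binomCoeff t k ^ 2 * ‖a‖ ^ (2 * k) := by
  have hsum := summable_pairMoment_bound ht ha
  have hle : ∀ m k, binomCoeff t m * pairMoment μ u a m k ≤ ‖a‖ ^ (2 * k) := fun m k => by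
    have h := mul_le_mul_of_nonneg_left (pairMoment_le hμ u a m k) (binomCoeff_pos ht m).le
    rwa [← mul_assoc, pairMoment_zero_right, hb, one_mul] at h
  have hlim := tendsto_tsum_of_dominated_convergence (𝓕 := atTop)
    (f := fun m k => binomCoeff t k ^ 2 * (binomCoeff t m * pairMoment μ u a m k)) hsum
    (fun k => (tendsto_mul_pairMoment hμ hu ha.le (binomCoeff_pos ht) hb
      (tendsto_binomCoeff_div_succ ht) k).const_mul _)
    (Eventually.of_forall fun m k => by
      rw [Real.norm_of_nonneg (mul_nonneg (sq_nonneg _)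
        (mul_nonneg (binomCoeff_pos ht m).le (pairMoment_nonneg μ u a m k)))]
      exact mul_le_mul_of_nonneg_left (hle m k) (sq_nonneg _))
  refine ⟨(1 - ‖a‖ ^ 2) ^ t * ∑' k, binomCoeff t k ^ 2 * ‖herm u a‖ ^ (2 * k), ?_, ?_⟩
  · refine (hlim.const_mul ((1 - ‖a‖ ^ 2) ^ t)).congr fun m => ?_
    rw [mul_left_comm, ← tsum_mul_left (a := binomCoeff t m)]
    exact congrArg (_ * ·) (tsum_congr fun k => by ring)
  · have hq : ‖herm u a‖ ≤ ‖a‖ := norm_herm_le_right a hu.le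
    have hterm : ∀ k, binomCoeff t k ^ 2 * ‖herm u a‖ ^ (2 * k) ≤
        binomCoeff t k ^ 2 * ‖a‖ ^ (2 * k) := fun k => by gcongr
    have h0 := Real.rpow_nonneg (one_sub_norm_sq_pos ha).le t
    exact mul_le_mul_of_nonneg_left ((Summable.of_nonneg_of_le (fun k => by positivity) hterm
      hsum).tsum_le_tsum hterm hsum) h0

/-! ### The norm of powers composed with the involution -/

theorem measurable_ballInvolution (a : CN N) : Measurable (ballInvolution a) := by
  have h := measurable_herm_left a
  exact (h.const_sub 1).inv.smul
    ((((h.const_mul _).const_sub 1).smul_const a).sub (measurable_const_smul _))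

/-- A constant times the `m`-th power of a linear form composed with the involution. -/
noncomputable def involutionPow (β : ℝ) (a u : CN N) (m : ℕ) (z : CN N) : ℂ :=
  β * herm (ballInvolution a z) u ^ m

theorem measurable_involutionPow (β : ℝ) (a u : CN N) (m : ℕ) :
    Measurable (involutionPow β a u m) :=
  (((measurable_herm_left u).comp (measurable_ballInvolution a)).pow_const m).const_mul _

/-- The substitution trades the involution for `P^t = (1-|a|²)^t |1-⟨z,a⟩|^(-2t)`; Parseval then
evaluates the integral. -/
theorem lintegral_involutionPow (hN : 0 < N) {s : ℝ} (hs : -1 < s) (hu : ‖u‖ ≤ 1) (ha : ‖a‖ < 1)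
    (β : ℝ) (m : ℕ) :
    ∫⁻ z, ‖involutionPow β a u m z‖ₑ ^ 2 ∂(weightedMeasure N s) =
      ENNReal.ofReal (β ^ 2 * ((1 - ‖a‖ ^ 2) ^ (N + s + 1) * ∑' k,
        binomCoeff (N + s + 1) k ^ 2 * pairMoment (weightedMeasure N s) u a m k)) := by
  have hN' : (1 : ℝ) ≤ N := by exact_mod_cast hN
  have ht : (0 : ℝ) < N + s + 1 := by linarith
  have hμ := isCircularMeasure_weightedMeasure hN hs
  have hE := homogeneousExpansion_ballKernel ht hu ha m
  rw [(hasSum_pairMoment ht hu ha m hμ).tsum_eq, ← mul_assoc, ← integral_const_mul,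
    ofReal_integral_eq_lintegral_ofReal]
  · refine (lintegral_comp_ballInvolution ha s fun w => ‖(β : ℂ) * herm w u ^ m‖ₑ ^ 2).trans ?_
    refine lintegral_congr fun z => ?_
    rw [← ofReal_norm, ← ENNReal.ofReal_pow (norm_nonneg _), ← ENNReal.ofReal_mul (Real.rpow_nonneg
      (poissonFactor_nonneg ha z) _), poissonFactor_rpow ha, norm_mul, norm_mul, Complex.norm_real,
      Real.norm_eq_abs, mul_pow, mul_pow, sq_abs]
    congr 1
    ring
  · refine (hμ.integrable (C := (∑' k, binomCoeff (N + s + 1) k * ‖a‖ ^ k) ^ 2) ?_ ?_).const_mul _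
    · exact ((((measurable_herm_left u).pow_const m).mul
        (measurable_ballKernel _ a)).norm.pow_const 2).aestronglyMeasurable
    · intro z hz
      rw [norm_pow, norm_norm, ← (hE.hasSum z hz).tsum_eq]
      gcongr
      exact tsum_of_norm_bounded hE.summable.hasSum fun k => hE.bound k z hz
  · refine Eventually.of_forall fun z => ?_
    have := Real.rpow_nonneg (one_sub_norm_sq_pos ha).le (N + s + 1)
    simp only [Pi.zero_apply]
    positivity

end BallSpaces

namespace BallSpaces

variable {N : ℕ} {a u : CN N} {t : ℝ}

/-! ### Hardy norms as limits of Bergman norms when `s → -1` -/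

theorem exists_homogeneousExpansion_involutionPow (ha : ‖a‖ < 1) (β : ℝ) (u : CN N) (m : ℕ) :
    ∃ (F : ℕ → CN N → ℂ) (c : ℕ → ℝ), HomogeneousExpansion 0 (involutionPow β a u m) F c := by
  obtain ⟨F₀, c₀, h₀⟩ := HomogeneousExpansion.exists_const (N := N) β
  obtain ⟨F₁, c₁, h₁⟩ := HomogeneousExpansion.exists_add_clm (herm a u)
    (-((1 + (defect a : ℂ))⁻¹ * herm a u) • hermCLM a - (defect a : ℂ) • hermCLM u)
  -- With `t = 1` and `m = 0` this is the geometric series for `1/(1-⟨z,a⟩)`, the denominator of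
  -- `φ_a`; `u = 0` is a dummy. The affine `h₁` is the numerator of `⟨φ_a(z), u⟩`.
  have h₂ := homogeneousExpansion_ballKernel (t := 1) (u := 0) one_pos (by simp) ha 0
  obtain ⟨F₃, c₃, h₃⟩ := (h₁.mul h₂).exists_pow m
  refine ⟨_, _, (h₀.mul h₃).congr fun z => ?_⟩
  simp only [involutionPow, ballInvolution, ballKernel, herm_smul_left, herm_sub_left, sub_apply, smul_apply,
    hermCLM_apply, pow_zero, one_mul, Complex.ofReal_one, Complex.cpow_one, smul_eq_mul]
  ring

/-- The Hardy norm of a function with a homogeneous expansion. -/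
theorem hardyNormSq_eq_of_homogeneousExpansion (hN : 0 < N) {f : CN N → ℂ} {F : ℕ → CN N → ℂ}
    {c : ℕ → ℝ} (h : HomogeneousExpansion 0 f F c) (hf : Measurable f) :
    hardyNormSq f = ENNReal.ofReal (∑' k, ∫ z, ‖F k z‖ ^ 2 ∂(surfaceMeasure N)) := by
  have hμ := isCircularMeasure_surfaceMeasure hN
  set A : ℕ → ℝ := fun k => ∫ z, ‖F k z‖ ^ 2 ∂(surfaceMeasure N) with hA
  have hA0 : ∀ k, 0 ≤ A k := fun k => integral_nonneg fun z => by positivity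
  have hAs : Summable A := (h.hasSum_integral_norm_sq hμ).summable
  have hterm : ∀ r ∈ Set.Ioo (0 : ℝ) 1, ∀ k, r ^ (2 * k) * A k ≤ A k := fun r hr k =>
    mul_le_of_le_one_left (hA0 k) (pow_le_one₀ hr.1.le hr.2.le)
  have hr : ∀ r ∈ Set.Ioo (0 : ℝ) 1,
      ∫⁻ ζ : sphere (0 : CN N) 1, ‖f (r • (ζ : CN N))‖ₑ ^ 2 ∂(sphereMeasure N) =
        ENNReal.ofReal (∑' k, r ^ (2 * k) * A k) := by
    intro r hr
    have hd := h.dilate hr.1.le hr.2.le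
    have h1 : ∀ k, ∫ z, ‖(r : ℂ) ^ k * F k z‖ ^ 2 ∂(surfaceMeasure N) = r ^ (2 * k) * A k := by
      intro k
      rw [hA, ← integral_const_mul]
      congr 1
      ext z
      rw [norm_mul, norm_pow, Complex.norm_real, Real.norm_of_nonneg hr.1.le, mul_pow, ← pow_mul,
        mul_comm k]
    have h2 := (hd.hasSum_integral_norm_sq hμ).tsum_eq
    simp only [h1] at h2
    rw [h2, ← lintegral_surfaceMeasure fun z => ‖f (r • z)‖ₑ ^ 2,
      ofReal_integral_eq_lintegral_ofReal]
    · refine lintegral_congr fun z => ?_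
      rw [← ofReal_norm, ← ENNReal.ofReal_pow (norm_nonneg _)]
    · refine hμ.integrable (C := (∑' k, c k) ^ 2) ?_ fun z hz => ?_
      · exact ((hf.comp (measurable_const_smul r)).norm.pow_const 2).aestronglyMeasurable
      · rw [norm_pow, norm_norm, ← (hd.hasSum z hz).tsum_eq]
        gcongr
        exact tsum_of_norm_bounded hd.summable.hasSum fun k => hd.bound k z hz
    · exact Eventually.of_forall fun z => by simp only [Pi.zero_apply]; positivity
  have hsum : ∀ r ∈ Set.Ioo (0 : ℝ) 1, Summable fun k => r ^ (2 * k) * A k := fun r hr =>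
    Summable.of_nonneg_of_le (fun k => mul_nonneg (pow_nonneg hr.1.le _) (hA0 k)) (hterm r hr) hAs
  refine le_antisymm (iSup₂_le fun r hr' => ?_) ?_
  · rw [hr r hr']
    exact ENNReal.ofReal_le_ofReal ((hsum r hr').tsum_le_tsum (hterm r hr') hAs)
  · have hlim : Tendsto (fun r : ℝ => ∑' k, r ^ (2 * k) * A k) (𝓝[<] 1) (𝓝 (∑' k, A k)) := by
      refine tendsto_tsum_of_dominated_convergence hAs (fun k => ?_) ?_
      · have : Continuous fun r : ℝ => r ^ (2 * k) * A k := by fun_prop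
        simpa using (this.tendsto 1).mono_left nhdsWithin_le_nhds
      · filter_upwards [Ioo_mem_nhdsLT one_pos] with r hr' k
        rw [Real.norm_of_nonneg (mul_nonneg (pow_nonneg hr'.1.le _) (hA0 k))]
        exact hterm r hr' k
    refine le_of_tendsto (ENNReal.tendsto_ofReal hlim) ?_
    filter_upwards [Ioo_mem_nhdsLT one_pos] with r hr'
    rw [← hr r hr']
    exact le_iSup₂ (f := fun (r : ℝ) (_ : r ∈ Set.Ioo (0 : ℝ) 1) =>
      ∫⁻ ζ : sphere (0 : CN N) 1, ‖f (r • (ζ : CN N))‖ₑ ^ 2 ∂(sphereMeasure N)) r hr'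

theorem integral_norm_sq_weightedMeasure (hN : 0 < N) {s : ℝ} (hs : -1 < s) {G : CN N → ℂ} {k : ℕ}
    (hG : IsHomogeneousFun G k) :
    ∫ z, ‖G z‖ ^ 2 ∂(weightedMeasure N s) =
      radialMoment N s (2 * k) * ∫ z, ‖G z‖ ^ 2 ∂(surfaceMeasure N) := by
  have h := integral_weightedMeasure_homogeneous hN hs (d := 2 * k)
    (G := fun z => ((‖G z‖ ^ 2 : ℝ) : ℂ)) (fun r hr z => by
      have h1 : G (r • z) = (r : ℂ) ^ k * G z := hG r z
      rw [h1, norm_mul, norm_pow, Complex.norm_real, Real.norm_of_nonneg hr.le]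
      push_cast
      ring)
  rw [integral_complex_ofReal, integral_complex_ofReal, ← Complex.ofReal_mul,
    Complex.ofReal_inj] at h
  rw [h, integral_surfaceMeasure]

theorem pairMoment_eq_integral_norm_sq (μ : Measure (CN N)) (u a : CN N) (m k : ℕ) :
    pairMoment μ u a m k = ∫ z, ‖herm z u ^ m * herm z a ^ k‖ ^ 2 ∂μ := by
  rw [pairMoment]
  congr 1
  ext z
  rw [norm_mul, norm_pow, norm_pow]
  ring

theorem isHomogeneousFun_herm_pow_mul (u a : CN N) (m k : ℕ) :
    IsHomogeneousFun (fun z => herm z u ^ m * herm z a ^ k) (m + k) := fun c z => by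
  simp only [herm_smul_left]
  ring

theorem radialMoment_two_mul_le_one (hN : 0 < N) {s : ℝ} (hs : -1 < s) (k : ℕ) :
    radialMoment N s (2 * k) ≤ 1 := by
  have hN' : (1 : ℝ) ≤ N := by exact_mod_cast hN
  rw [radialMoment_two_mul hN hs, div_le_one (binomCoeff_pos (by linarith) k)]
  exact binomCoeff_mono (by linarith) (by linarith) k

/-- A sequence of weights decreasing to `-1`. -/
noncomputable def weightSeq (n : ℕ) : ℝ := -1 + 1 / (n + 1)

theorem neg_one_lt_weightSeq (n : ℕ) : -1 < weightSeq n := by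
  have : (0 : ℝ) < 1 / (n + 1) := by positivity
  rw [weightSeq]
  linarith

theorem weightSeq_le_zero (n : ℕ) : weightSeq n ≤ 0 := by
  have : 1 / ((n : ℝ) + 1) ≤ 1 := by
    rw [div_le_one (by positivity)]
    linarith [(n.cast_nonneg : (0 : ℝ) ≤ n)]
  rw [weightSeq]
  linarith

theorem tendsto_add_weightSeq (N : ℕ) :
    Tendsto (fun n => (N : ℝ) + weightSeq n + 1) atTop (𝓝 N) := by
  have h := (tendsto_one_div_add_atTop_nhds_zero_nat (𝕜 := ℝ)).const_add (N : ℝ)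
  rw [add_zero] at h
  refine h.congr fun n => ?_
  rw [weightSeq]
  ring

theorem tendsto_radialMoment_weightSeq (hN : 0 < N) (k : ℕ) :
    Tendsto (fun n => radialMoment N (weightSeq n) (2 * k)) atTop (𝓝 1) := by
  have hN' : (1 : ℝ) ≤ N := by exact_mod_cast hN
  have hpos : (0 : ℝ) < N := by linarith
  have h := (tendsto_const_nhds (x := binomCoeff N k)).div
    (tendsto_binomCoeff (fun n => by linarith [neg_one_lt_weightSeq n]) hpos
      (tendsto_add_weightSeq N) k) (binomCoeff_pos hpos k).ne'
  rw [div_self (binomCoeff_pos hpos k).ne'] at h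
  exact h.congr fun n => (radialMoment_two_mul hN (neg_one_lt_weightSeq n) k).symm

/-- For `s > -1` the Bergman norm has two expressions: Parseval for the expansion of the function
itself, and `lintegral_involutionPow`. As `s → -1` the radial moments tend to `1`, so the first
tends to the Hardy norm and the second to the stated formula. -/
theorem hardyNormSq_involutionPow (hN : 0 < N) (hu : ‖u‖ ≤ 1) (ha : ‖a‖ < 1) (β : ℝ) (m : ℕ) :
    hardyNormSq (involutionPow β a u m) =
      ENNReal.ofReal (β ^ 2 * ((1 - ‖a‖ ^ 2) ^ (N : ℝ) * ∑' k,
        binomCoeff N k ^ 2 * pairMoment (surfaceMeasure N) u a m k)) := by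
  have hN' : (1 : ℝ) ≤ N := by exact_mod_cast hN
  have hpos : (0 : ℝ) < N := by linarith
  have hs := neg_one_lt_weightSeq
  have ht : ∀ n, (0 : ℝ) < N + weightSeq n + 1 := fun n => by linarith [hs n]
  have hμ := isCircularMeasure_surfaceMeasure hN
  have := isProbabilityMeasure_surfaceMeasure hN
  obtain ⟨F, c, hF⟩ := exists_homogeneousExpansion_involutionPow ha β u m
  have hmeas := measurable_involutionPow β a u m
  rw [hardyNormSq_eq_of_homogeneousExpansion hN hF hmeas]
  congr 1
  set A : ℕ → ℝ := fun k => ∫ z, ‖F k z‖ ^ 2 ∂(surfaceMeasure N) with hA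
  have hA0 : ∀ k, 0 ≤ A k := fun k => integral_nonneg fun z => by positivity
  have hAs : Summable A := (hF.hasSum_integral_norm_sq hμ).summable
  have hκ0 : ∀ n k, 0 ≤ radialMoment N (weightSeq n) (2 * k) := fun n k =>
    (radialMoment_pos hN (hs n) _).le
  have hκ1 : ∀ n k, radialMoment N (weightSeq n) (2 * k) ≤ 1 := fun n k =>
    radialMoment_two_mul_le_one hN (hs n) k
  have hlhs : Tendsto (fun n => ∑' k, radialMoment N (weightSeq n) (2 * k) * A k) atTop
      (𝓝 (∑' k, A k)) := by
    refine tendsto_tsum_of_dominated_convergence hAs (fun k => ?_)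
      (Eventually.of_forall fun n k => ?_)
    · simpa using (tendsto_radialMoment_weightSeq hN k).mul_const (A k)
    · rw [Real.norm_of_nonneg (mul_nonneg (hκ0 n k) (hA0 k))]
      exact mul_le_of_le_one_left (hA0 k) (hκ1 n k)
  set B : ℕ → ℝ := fun k => pairMoment (surfaceMeasure N) u a m k with hB
  have hB0 : ∀ k, 0 ≤ B k := fun k => pairMoment_nonneg _ u a m k
  have hB1 : ∀ k, B k ≤ ‖a‖ ^ (2 * k) := by
    intro k
    refine (pairMoment_le hμ u a m k).trans (mul_le_of_le_one_left (by positivity) ?_)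
    have hi : Integrable (fun z => ‖herm z u‖ ^ (2 * m)) (surfaceMeasure N) := by
      simpa using integrable_pairMoment_integrand hμ u a m 0
    calc pairMoment (surfaceMeasure N) u a m 0 ≤ ∫ _, (1 : ℝ) ∂(surfaceMeasure N) := by
          rw [pairMoment_zero_right]
          exact integral_mono_ae hi (integrable_const 1)
            (hμ.ae_norm_le.mono fun z hz => pow_le_one₀ (norm_nonneg _) (norm_herm_le_one hu hz))
      _ = 1 := by simp
  have hrhs : Tendsto (fun n => ∑' k, binomCoeff (N + weightSeq n + 1) k ^ 2 *
      (radialMoment N (weightSeq n) (2 * (m + k)) * B k)) atTop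
      (𝓝 (∑' k, binomCoeff N k ^ 2 * B k)) := by
    -- The parameters `N + s_n + 1` stay at most `N + 1`, so the coefficients for `N + 1` give a
    -- majorant uniform in `n`.
    refine tendsto_tsum_of_dominated_convergence
      (summable_pairMoment_bound (t := N + 1) (by linarith) ha) (fun k => ?_)
      (Eventually.of_forall fun n k => ?_)
    · simpa using ((tendsto_binomCoeff ht hpos (tendsto_add_weightSeq N) k).pow 2).mul
        ((tendsto_radialMoment_weightSeq hN (m + k)).mul_const (B k))
    · rw [Real.norm_of_nonneg (mul_nonneg (sq_nonneg _) (mul_nonneg (hκ0 n _) (hB0 k)))]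
      have h1 := binomCoeff_mono (ht n) (by linarith [weightSeq_le_zero n] :
        (N : ℝ) + weightSeq n + 1 ≤ N + 1) k
      have h2 := (binomCoeff_pos (ht n) k).le
      have h3 : radialMoment N (weightSeq n) (2 * (m + k)) * B k ≤ ‖a‖ ^ (2 * k) :=
        (mul_le_of_le_one_left (hB0 k) (hκ1 n _)).trans (hB1 k)
      have := mul_nonneg (hκ0 n (m + k)) (hB0 k)
      gcongr
  have hpow : Tendsto (fun n => (1 - ‖a‖ ^ 2) ^ ((N : ℝ) + weightSeq n + 1)) atTop
      (𝓝 ((1 - ‖a‖ ^ 2) ^ (N : ℝ))) :=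
    tendsto_const_nhds.rpow (tendsto_add_weightSeq N) (Or.inl (one_sub_norm_sq_pos ha).ne')
  refine tendsto_nhds_unique hlhs (((hpow.mul hrhs).const_mul (β ^ 2)).congr fun n => ?_)
  have hν := isCircularMeasure_weightedMeasure hN (hs n)
  have h1 := (hF.hasSum_integral_norm_sq hν).tsum_eq
  have h2 := lintegral_involutionPow hN (hs n) hu ha β m
  have h3 : ∫ z, ‖involutionPow β a u m z‖ ^ 2 ∂(weightedMeasure N (weightSeq n)) =
      β ^ 2 * ((1 - ‖a‖ ^ 2) ^ (N + weightSeq n + 1) * ∑' k,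
        binomCoeff (N + weightSeq n + 1) k ^ 2 *
          pairMoment (weightedMeasure N (weightSeq n)) u a m k) := by
    have h4 : 0 ≤ β ^ 2 * ((1 - ‖a‖ ^ 2) ^ (N + weightSeq n + 1) * ∑' k,
        binomCoeff (N + weightSeq n + 1) k ^ 2 *
          pairMoment (weightedMeasure N (weightSeq n)) u a m k) :=
      mul_nonneg (sq_nonneg _) (mul_nonneg (Real.rpow_nonneg (one_sub_norm_sq_pos ha).le _)
        (tsum_nonneg fun k => mul_nonneg (sq_nonneg _) (pairMoment_nonneg _ u a m k)))
    rw [← ENNReal.toReal_ofReal h4, ← h2, integral_eq_lintegral_of_nonneg_ae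
      (Eventually.of_forall fun z => by simp only [Pi.zero_apply]; positivity)
      (hmeas.norm.pow_const 2).aestronglyMeasurable]
    congr 1
    refine lintegral_congr fun z => ?_
    rw [ENNReal.ofReal_pow (norm_nonneg _), ofReal_norm]
  rw [h3] at h1
  have h5 : ∀ k, ∫ z, ‖F k z‖ ^ 2 ∂(weightedMeasure N (weightSeq n)) =
      radialMoment N (weightSeq n) (2 * k) * A k := fun k =>
    integral_norm_sq_weightedMeasure hN (hs n) (hF.homogeneous k)
  have h6 : ∀ k, pairMoment (weightedMeasure N (weightSeq n)) u a m k =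
      radialMoment N (weightSeq n) (2 * (m + k)) * B k := fun k => by
    simp only [hB, pairMoment_eq_integral_norm_sq]
    exact integral_norm_sq_weightedMeasure hN (hs n) (isHomogeneousFun_herm_pow_mul u a m k)
  simp only [h5, h6] at h1
  exact h1.symm

/-! ### Membership -/

theorem hardyNormSq_lt_top (hN : 0 < N) {f : CN N → ℂ} {C : ℝ}
    (hC : ∀ z ∈ unitBall N, ‖f z‖ ≤ C) : hardyNormSq f < ∞ := by
  have := isProbabilityMeasure_sphereMeasure hN
  refine lt_of_le_of_lt (iSup₂_le fun r hr => ?_) (ENNReal.ofReal_lt_top (r := C ^ 2))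
  calc ∫⁻ ζ : sphere (0 : CN N) 1, ‖f (r • (ζ : CN N))‖ₑ ^ 2 ∂(sphereMeasure N)
      ≤ ∫⁻ _ : sphere (0 : CN N) 1, ENNReal.ofReal (C ^ 2) ∂(sphereMeasure N) := by
        refine lintegral_mono fun ζ => ?_
        rw [← ofReal_norm, ← ENNReal.ofReal_pow (norm_nonneg _)]
        refine ENNReal.ofReal_le_ofReal ?_
        gcongr
        refine hC _ ?_
        rw [mem_ball_zero_iff, norm_smul, Real.norm_of_nonneg hr.1.le]
        simpa using hr.2
    _ = ENNReal.ofReal (C ^ 2) := by simp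

theorem bergmanNormSq_eq_lintegral (s : ℝ) (f : CN N → ℂ) :
    bergmanNormSq s f = ∫⁻ z, ‖f z‖ₑ ^ 2 ∂(weightedMeasure N s) := by
  rw [bergmanNormSq, Measure.restrict_eq_self_of_ae_mem (ae_weightedMeasure N s)]

theorem bergmanNormSq_lt_top (hN : 0 < N) {s : ℝ} (hs : -1 < s) {f : CN N → ℂ} {C : ℝ}
    (hC : ∀ z ∈ unitBall N, ‖f z‖ ≤ C) : bergmanNormSq s f < ∞ := by
  have := isProbabilityMeasure_weightedMeasure hN hs
  rw [bergmanNormSq_eq_lintegral]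
  refine lt_of_le_of_lt ?_ (ENNReal.ofReal_lt_top (r := C ^ 2))
  calc ∫⁻ z, ‖f z‖ₑ ^ 2 ∂(weightedMeasure N s)
      ≤ ∫⁻ _, ENNReal.ofReal (C ^ 2) ∂(weightedMeasure N s) := by
        refine lintegral_mono_ae ((ae_weightedMeasure N s).mono fun z hz => ?_)
        rw [← ofReal_norm, ← ENNReal.ofReal_pow (norm_nonneg _)]
        refine ENNReal.ofReal_le_ofReal ?_
        gcongr
        exact hC z hz
    _ = ENNReal.ofReal (C ^ 2) := by simp

theorem hardyNormSq_congr {f g : CN N → ℂ} (h : Set.EqOn f g (unitBall N)) :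
    hardyNormSq f = hardyNormSq g := by
  refine iSup_congr fun r => iSup_congr fun hr => lintegral_congr fun ζ => ?_
  rw [h]
  rw [mem_ball_zero_iff, norm_smul, Real.norm_of_nonneg hr.1.le]
  simpa using hr.2

theorem bergmanNormSq_congr (s : ℝ) {f g : CN N → ℂ} (h : Set.EqOn f g (unitBall N)) :
    bergmanNormSq s f = bergmanNormSq s g :=
  setLIntegral_congr_fun measurableSet_ball fun z hz => by rw [h hz]

theorem differentiable_testFun (t : ℝ) (a : CN N) (m : ℕ) : Differentiable ℂ (testFun t a m) :=
  (((hermCLM ((‖a‖⁻¹ : ℝ) • a)).differentiable).pow m).const_mul _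

theorem norm_inv_smul_self (ha0 : a ≠ 0) : ‖(‖a‖⁻¹ : ℝ) • a‖ = 1 := by
  rw [norm_smul, norm_inv, norm_norm, inv_mul_cancel₀ (norm_ne_zero_iff.2 ha0)]

theorem norm_testFun_le (ha0 : a ≠ 0) (t : ℝ) (m : ℕ) {z : CN N} (hz : z ∈ unitBall N) :
    ‖testFun t a m z‖ ≤ √(Real.Gamma (t + m) / (Real.Gamma t * m.factorial)) := by
  rw [testFun, norm_mul, norm_pow, Complex.norm_real, Real.norm_of_nonneg (Real.sqrt_nonneg _)]
  exact mul_le_of_le_one_right (Real.sqrt_nonneg _) (pow_le_one₀ (norm_nonneg _)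
    (norm_herm_le_one (norm_inv_smul_self ha0).le (mem_ball_zero_iff.1 hz).le))

/-- Composing the test functions with an automorphism vanishing at `a`. -/
theorem IsBallAutomorphism.exists_eqOn_involutionPow {φ : CN N → CN N} (hφ : IsBallAutomorphism φ)
    (ha : a ∈ unitBall N) (hφa : φ a = 0) (ha0 : a ≠ 0) :
    ∃ u : CN N, ‖u‖ = 1 ∧ ∀ (t : ℝ) (m : ℕ), Set.EqOn (compositionOp φ (testFun t a m))
      (involutionPow (√(binomCoeff t m)) a u m) (unitBall N) := by
  obtain ⟨U, hU⟩ := hφ.exists_unitary ha hφa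
  refine ⟨U.symm ((‖a‖⁻¹ : ℝ) • a), by rw [U.symm.norm_map, norm_inv_smul_self ha0],
    fun t m z hz => ?_⟩
  rw [compositionOp, Function.comp_apply, testFun, hU z hz, herm_unitary, involutionPow, binomCoeff,
    mul_comm (m.factorial : ℝ)]

end BallSpaces

/-! ### Conclusion for the Hardy and Bergman spaces -/

theorem proposition3p4 (N : ℕ) (φ : BallSpaces.CN N → BallSpaces.CN N)
    (hφ : BallSpaces.IsBallAutomorphism φ) (a : BallSpaces.CN N)
    (ha : a ∈ BallSpaces.unitBall N) (hφa : φ a = 0) (ha0 : a ≠ 0) :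
    -- the Hardy space, with t = N
    ((∀ m : ℕ, BallSpaces.testFun (N : ℝ) a m ∈ BallSpaces.hardySpace N ∧
        BallSpaces.compositionOp φ (BallSpaces.testFun (N : ℝ) a m) ∈ BallSpaces.hardySpace N) ∧
      Summable (fun k : ℕ =>
        (Real.Gamma ((N : ℝ) + k) / (k.factorial * Real.Gamma (N : ℝ))) ^ 2 * ‖a‖ ^ (2 * k)) ∧
      ∃ L : ℝ,
        Tendsto (fun m : ℕ =>
          (BallSpaces.hardyNormSq
            (BallSpaces.compositionOp φ (BallSpaces.testFun (N : ℝ) a m))).toReal)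
          atTop (𝓝 L) ∧
        L ≤ (1 - ‖a‖ ^ 2) ^ (N : ℝ) * ∑' k : ℕ,
          (Real.Gamma ((N : ℝ) + k) / (k.factorial * Real.Gamma (N : ℝ))) ^ 2 *
            ‖a‖ ^ (2 * k)) ∧
    -- the weighted Bergman spaces, with t = N + s + 1
    (∀ s : ℝ, -1 < s → ∀ t : ℝ, t = N + s + 1 →
      (∀ m : ℕ, BallSpaces.testFun t a m ∈ BallSpaces.bergmanSpace N s ∧
        BallSpaces.compositionOp φ (BallSpaces.testFun t a m) ∈ BallSpaces.bergmanSpace N s) ∧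
      Summable (fun k : ℕ =>
        (Real.Gamma (t + k) / (k.factorial * Real.Gamma t)) ^ 2 * ‖a‖ ^ (2 * k)) ∧
      ∃ L : ℝ,
        Tendsto (fun m : ℕ =>
          (BallSpaces.bergmanNormSq s
            (BallSpaces.compositionOp φ (BallSpaces.testFun t a m))).toReal)
          atTop (𝓝 L) ∧
        L ≤ (1 - ‖a‖ ^ 2) ^ t * ∑' k : ℕ,
          (Real.Gamma (t + k) / (k.factorial * Real.Gamma t)) ^ 2 * ‖a‖ ^ (2 * k)) := by
  -- In dimension `0` no nonzero `a` exists.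
  have hN : 0 < N := by
    rcases Nat.eq_zero_or_pos N with rfl | h
    · exact absurd (Subsingleton.elim a 0) ha0
    · exact h
  have hN' : (1 : ℝ) ≤ N := by exact_mod_cast hN
  have ha1 : ‖a‖ < 1 := mem_ball_zero_iff.1 ha
  have hpos : ∀ (t : ℝ) (μ : Measure (BallSpaces.CN N)) (u : BallSpaces.CN N) (m : ℕ), 0 < t →
      0 ≤ BallSpaces.binomCoeff t m * ((1 - ‖a‖ ^ 2) ^ t * ∑' k,
        BallSpaces.binomCoeff t k ^ 2 * BallSpaces.pairMoment μ u a m k) := fun t μ u m ht =>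
    mul_nonneg (BallSpaces.binomCoeff_pos ht m).le (mul_nonneg
      (Real.rpow_nonneg (BallSpaces.one_sub_norm_sq_pos ha1).le _)
      (tsum_nonneg fun k => mul_nonneg (sq_nonneg _) (BallSpaces.pairMoment_nonneg _ u a m k)))
  obtain ⟨u, hu, hcomp⟩ := hφ.exists_eqOn_involutionPow ha hφa ha0
  obtain ⟨hφd, hφm, -⟩ := hφ
  have hd : ∀ t m, DifferentiableOn ℂ (BallSpaces.testFun t a m) (BallSpaces.unitBall N) :=
    fun t m => (BallSpaces.differentiable_testFun t a m).differentiableOn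
  have hb : ∀ t m, ∀ z ∈ BallSpaces.unitBall N, ‖BallSpaces.testFun t a m z‖ ≤
      √(Real.Gamma (t + m) / (Real.Gamma t * m.factorial)) :=
    fun t m z hz => BallSpaces.norm_testFun_le ha0 t m hz
  refine ⟨⟨fun m => ⟨⟨hd _ m, BallSpaces.hardyNormSq_lt_top hN (hb _ m)⟩,
    (hd _ m).comp hφd hφm, BallSpaces.hardyNormSq_lt_top hN fun z hz => hb _ m _ (hφm hz)⟩,
    BallSpaces.summable_pairMoment_bound (by linarith) ha1, ?_⟩, ?_⟩
  · have ht : (0 : ℝ) < N := by linarith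
    obtain ⟨L, hL, hL'⟩ := BallSpaces.exists_tendsto_tsum_pairMoment
      (BallSpaces.isCircularMeasure_surfaceMeasure hN) hu ht ha1
      (BallSpaces.binomCoeff_mul_integral_surfaceMeasure hN hu)
    refine ⟨L, hL.congr fun m => ?_, hL'⟩
    rw [BallSpaces.hardyNormSq_congr (hcomp _ m),
      BallSpaces.hardyNormSq_involutionPow hN hu.le ha1, Real.sq_sqrt
      (BallSpaces.binomCoeff_pos ht m).le, ENNReal.toReal_ofReal (hpos _ _ u m ht)]
  · rintro s hs t rfl
    have ht : (0 : ℝ) < N + s + 1 := by linarith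
    refine ⟨fun m => ⟨⟨hd _ m, BallSpaces.bergmanNormSq_lt_top hN hs (hb _ m)⟩,
      (hd _ m).comp hφd hφm, BallSpaces.bergmanNormSq_lt_top hN hs fun z hz => hb _ m _ (hφm hz)⟩,
      BallSpaces.summable_pairMoment_bound ht ha1, ?_⟩
    obtain ⟨L, hL, hL'⟩ := BallSpaces.exists_tendsto_tsum_pairMoment
      (BallSpaces.isCircularMeasure_weightedMeasure hN hs) hu ht ha1
      (BallSpaces.binomCoeff_mul_integral_weightedMeasure hN hs hu)
    refine ⟨L, hL.congr fun m => ?_, hL'⟩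
    rw [BallSpaces.bergmanNormSq_congr s (hcomp _ m), BallSpaces.bergmanNormSq_eq_lintegral,
      BallSpaces.lintegral_involutionPow hN hs hu.le ha1, Real.sq_sqrt
      (BallSpaces.binomCoeff_pos ht m).le, ENNReal.toReal_ofReal (hpos _ _ u m ht)]
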